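/- For $\lambda\in(\tfrac12,1)$ let $\nu_\lambda$ be the unbiased Bernoulli convolution, i.e. the distribution of the random series $\sum_{n\ge1} i_n\lambda^n$, where the $i_n$ are i.i.d. and take the values $0,1$ with probability $\tfrac12$ each, and let $I_\lambda=[0,\frac{\lambda}{1-\lambda}]$ (its support). Write $s(\lambda)=\log 2/|\log\lambda|$ and $g=\frac{\sqrt5-1}{2}$. The local dimension of a measure $\mu$ on $\mathbb R$ at $x$ is $d(\mu,x)=\lim_{r\searrow0}\frac{\log\mu(B(x,r))}{\log r}$, where $B(x,r)$ is the open ball, provided that the limit exists. Let $\beta_c$ be the Komornik–Loreti constant, the unique positive solution $x$ of $1=\sum_{n\ge1}\mathfrak m_n x^{-n+1}$, where $(\mathfrak m_n)_{n\ge1}=0110\,1001\,1001\,0110\ldots$ is the Thue–Morse sequence. Let $\mathcal A_\lambda$ be the set of $x\in I_\lambda$ for which there is exactly one sequence $(a_n)_{n\ge1}\in\{0,1\}^{\mathbb N}$ with $x=\sum_{n\ge1}a_n\lambda^n$. Let $C_\lambda=[\lambda,\frac{\lambda^2}{1-\lambda}]$, and let $F_\lambda:I_\lambda\setminus C_\lambda\to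 I_\lambda$ be given by $F_\lambda(x)=x/\lambda$ for $x\in[0,\lambda)$ and $F_\lambda(x)=x/\lambda-1$ for $x\in(\frac{\lambda^2}{1-\lambda},\frac{\lambda}{1-\lambda}]$; the infinite orbit $(F_\lambda^n x)_{n\ge0}$ is well defined for every $x\in\mathcal A_\lambda$. Put $$\widetilde{\mathcal A}_\lambda=\bigcup_{\delta>0}\bigl\{x\in\mathcal A_\lambda:\ \operatorname{dist}(\{F_\lambda^n x\}_{n\ge0},C_\lambda)\ge\delta\bigr\}.$$ **Theorem.** For every $\lambda\in(\tfrac12,g)$ the set $\widetilde{\mathcal A}_\lambda\subset I_\lambda$ satisfies: for every $x\in\widetilde{\mathcal A}_\lambda$ the local dimension of $\nu_\lambda$ at $x$ exists, and $d(\nu_\lambda,x)=s(\lambda)$, where $s(\lambda)>1$. Moreover, (i) $\widetilde{\mathcal A}_\lambda$ is countably infinite for every $\lambda\in(\beta_c^{-1},g)$; (ii) $\dim_H\widetilde{\mathcal A}_\lambda>0$ for every $\lambda\in(\tfrac12,\beta_c^{-1})$; (iii) $\dim_H\widetilde{\mathcal A}_\lambda\to1$ as $\lambda\searrow\tfrac12$.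 -/

import Mathlib

open Set Filter Topology MeasureTheory

noncomputable section

namespace BernoulliConv

/-! Expansions `x = ∑_{n ≥ 1} a_n l^n` with digits 0, 1. A digit sequence `(a_1, a_2, …)` is a
function `a : ℕ → Fin 2`, where `a n` is the digit `a_{n+1}`. The base is written `l` (for lambda). -/

/-- The natural projection `Π_l(a) = ∑_{n ≥ 1} a_n l^n`. -/
def proj (l : ℝ) (a : ℕ → Fin 2) : ℝ := ∑' n : ℕ, ((a n : ℕ) : ℝ) * l ^ (n + 1)

/-- The fair coin: the probability measure on `{0, 1}` with weights `1/2, 1/2`. -/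
def fairCoin : Measure (Fin 2) := (PMF.uniformOfFintype (Fin 2)).toMeasure

instance : IsProbabilityMeasure fairCoin := by
  unfold fairCoin; infer_instance

/-- The unbiased Bernoulli convolution: the law of `∑_{n ≥ 1} i_n l^n`, where the `i_n` are
independent and take the values 0, 1 with probability 1/2 each. -/
def bernoulliConvolution (l : ℝ) : Measure ℝ :=
  (Measure.infinitePi (fun _ : ℕ => fairCoin)).map (proj l)

/-- The projection is measurable, so that the push-forward above is the intended one. -/
theorem measurable_proj {l : ℝ} (h0 : 0 < l) (h1 : l < 1) : Measurable (proj l) := by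
  have hc : Continuous (proj l) := by
    unfold proj
    refine continuous_tsum (u := fun n : ℕ => l ^ n) ?_ (summable_geometric_of_lt_one h0.le h1) ?_
    · intro n
      have : Continuous fun i : Fin 2 => ((i : ℕ) : ℝ) := continuous_of_discreteTopology
      exact (this.comp (continuous_apply n)).mul continuous_const
    · intro n a
      have h2 : ((a n : ℕ) : ℝ) ≤ 1 := by
        have : (a n : ℕ) ≤ 1 := by omega
        exact_mod_cast this
      have h3 : l ^ (n + 1) ≤ l ^ n := pow_le_pow_of_le_one h0.le h1.le (Nat.le_succ n)
      rw [Real.norm_of_nonneg (by positivity)]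
      calc ((a n : ℕ) : ℝ) * l ^ (n + 1) ≤ 1 * l ^ (n + 1) := by gcongr
        _ ≤ l ^ n := by simpa using h3
  exact hc.measurable

/-- The local dimension of `μ` at `x` exists and equals `d`. -/
def HasLocalDim (μ : Measure ℝ) (x d : ℝ) : Prop :=
  Tendsto (fun r : ℝ => Real.log (μ (Metric.ball x r)).toReal / Real.log r) (𝓝[>] 0) (𝓝 d)

/-- The similarity dimension `s(l) = log 2 / |log l|`. -/
def simDim (l : ℝ) : ℝ := Real.log 2 / |Real.log l|

/-- The reciprocal golden ratio. -/
def recGolden : ℝ := (√5 - 1) / 2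

/-- The interval `I_l = [0, l / (1 - l)]`, the support of the Bernoulli convolution. -/
def suppInterval (l : ℝ) : Set ℝ := Icc 0 (l / (1 - l))

/-- The set of all expansions of `x` in base `l`. -/
def expansions (l x : ℝ) : Set (ℕ → Fin 2) := {a | x = proj l a}

/-- The set of points of `I_l` that have exactly one expansion in base `l`. -/
def uniqueExp (l : ℝ) : Set ℝ := {x ∈ suppInterval l | (expansions l x).encard = 1}

/-- The overlap region `C_l = [l, l² / (1 - l)]`. -/
def overlap (l : ℝ) : Set ℝ := Icc l (l ^ 2 / (1 - l))

open Classical in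
/-- The map `F` that sends `x` to `x / l` on `[0, l)` and to `x / l - 1` on
`(l² / (1 - l), l / (1 - l)]`. Its domain is `I_l` without `C_l`; the values elsewhere are
irrelevant, because the orbit of a point with a unique expansion stays in this domain. -/
def expMap (l x : ℝ) : ℝ := if x < l then x / l else x / l - 1

/-- The points with a unique expansion whose orbit under `F` stays at a positive distance from
the overlap region. -/
def wellSepUniqueExp (l : ℝ) : Set ℝ :=
  {x ∈ uniqueExp l | ∃ δ > 0, ∀ n : ℕ, ∀ c ∈ overlap l, δ ≤ dist ((expMap l)^[n] x) c}

/-- The Thue–Morse sequence `0110 1001 1001 0110 …`, indexed from 0: the parity of the sum of the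
binary digits of `n`. -/
def thueMorse (n : ℕ) : ℕ := (Nat.digits 2 n).sum % 2

/-- `x` is a positive solution of `1 = ∑_{n ≥ 1} m_n x^{-n+1}`, where `m_n` is the Thue–Morse
sequence indexed from 1. -/
def IsKomornikLoreti (x : ℝ) : Prop :=
  0 < x ∧ HasSum (fun n : ℕ => (thueMorse n : ℝ) * (x ^ n)⁻¹) 1

theorem existsUnique_isKomornikLoreti : ∃! x : ℝ, IsKomornikLoreti x := by
  have t0 : thueMorse 0 = 0 := by simp [thueMorse]
  have t1 : thueMorse 1 = 1 := by simp [thueMorse]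
  have t2 : thueMorse 2 = 1 := by simp [thueMorse]
  have hle : ∀ n, (thueMorse n : ℝ) ≤ 1 := fun n => by
    have : thueMorse n ≤ 1 := by unfold thueMorse; omega
    exact_mod_cast this
  have h5 : √5 ^ 2 = 5 := Real.sq_sqrt (by norm_num)
  have h5n : 0 ≤ √5 := Real.sqrt_nonneg 5
  set g : ℝ := (√5 - 1) / 2 with hg
  have hg0 : 0 < g := by nlinarith
  have hg1 : g < 1 := by nlinarith
  have hgg : g + g ^ 2 = 1 := by rw [hg]; nlinarith
  have hbd : ∀ n : ℕ, ∀ y ∈ Icc 0 g, ‖(thueMorse n : ℝ) * y ^ n‖ ≤ g ^ n := by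
    intro n y hy
    have hy0 := hy.1
    rw [Real.norm_of_nonneg (by positivity)]
    calc (thueMorse n : ℝ) * y ^ n ≤ 1 * g ^ n := by
          gcongr
          · exact hle n
          · exact hy.2
      _ = g ^ n := one_mul _
  have hs := summable_geometric_of_lt_one hg0.le hg1
  have hcont : ContinuousOn (fun y : ℝ => ∑' n : ℕ, (thueMorse n : ℝ) * y ^ n) (Icc 0 g) :=
    continuousOn_tsum (fun n => by fun_prop) hs hbd
  have hsum : ∀ y ∈ Icc 0 g, Summable fun n : ℕ => (thueMorse n : ℝ) * y ^ n := fun y hy =>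
    Summable.of_norm_bounded hs (fun n => hbd n y hy)
  have hz : ∑' n : ℕ, (thueMorse n : ℝ) * (0 : ℝ) ^ n = 0 := by
    rw [← tsum_zero (α := ℝ) (β := ℕ)]
    congr 1
    funext n
    rcases n with _ | n
    · simp [t0]
    · simp
  have hge : 1 ≤ ∑' n : ℕ, (thueMorse n : ℝ) * g ^ n := by
    have := (hsum g ⟨hg0.le, le_rfl⟩).sum_le_tsum (Finset.range 3) (fun n _ => by positivity)
    simp [Finset.sum_range_succ, t0, t1, t2] at this
    linarith
  obtain ⟨y, hy, hy1⟩ := intermediate_value_Icc hg0.le hcont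
    (show (1 : ℝ) ∈ Icc _ _ from ⟨by simp only [hz]; exact zero_le_one, hge⟩)
  have hy0 : 0 < y := by
    rcases hy.1.lt_or_eq with h | h
    · exact h
    · simp only [← h, hz] at hy1
      exact absurd hy1 zero_ne_one
  have key : ∀ u v : ℝ, IsKomornikLoreti u → IsKomornikLoreti v → ¬ u < v := by
    rintro u v ⟨hu, hus⟩ ⟨hv, hvs⟩ huv
    refine lt_irrefl (1 : ℝ) (hasSum_lt (i := 1) ?_ ?_ hvs hus)
    · intro n
      have : u ^ n ≤ v ^ n := pow_le_pow_left₀ hu.le huv.le n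
      have h2 : (v ^ n)⁻¹ ≤ (u ^ n)⁻¹ := inv_anti₀ (by positivity) this
      exact mul_le_mul_of_nonneg_left h2 (by positivity)
    · simpa [t1] using inv_strictAnti₀ hu huv
  refine ⟨y⁻¹, ⟨inv_pos.2 hy0, ?_⟩, ?_⟩
  · have := (hsum y hy).hasSum
    simp only [] at hy1
    rw [hy1] at this
    simpa using this
  · intro z hz'
    have hyk : IsKomornikLoreti y⁻¹ := by
      refine ⟨inv_pos.2 hy0, ?_⟩
      have := (hsum y hy).hasSum
      simp only [] at hy1
      rw [hy1] at this
      simpa using this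
    exact le_antisymm (not_lt.1 (key _ _ hyk hz')) (not_lt.1 (key _ _ hz' hyk))

/-- The Komornik–Loreti constant. -/
def komornikLoreti : ℝ := existsUnique_isKomornikLoreti.choose

theorem isKomornikLoreti_komornikLoreti : IsKomornikLoreti komornikLoreti :=
  existsUnique_isKomornikLoreti.choose_spec.1

end BernoulliConv

end

open BernoulliConv

noncomputable section
namespace BernoulliConv

/-! At a digit 0 of an expansion `a`, the orbit point is l times the projection of the tail behind
that digit. It lies at least lε below the overlap region iff this projection is at most 1 - ε
(`HalfSep`). The reflection x ↦ l/(1-l) - x handles the digits 1. So the set consists of the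
projections of those `a` for which `a` and `flip a` satisfy `HalfSep` with some ε > 0
(`mem_wellSepUniqueExp_iff`). Any sequence that leaves such an `a` at place p projects at distance
at least l^(p+1) ε (`le_abs_proj_sub`). Hence balls of radius comparable to l^n have mass comparable
to 2^(-n), which is the local dimension. For the same reason, coding the full shift by such
sequences bounds the Hausdorff dimension from below (`le_dimH_of_coding`).

The threshold is governed by T = `morseTail`, which projects to 1 at the inverse Komornik–Loreti
constant. With φ = `morse` one has T = 1φ(T). Below the threshold, every φ^n(c) has its tails behind
a 0 lexicographically at most T within 2^n - 1 digits, which yields `HalfSep` once n is large. So a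
copy of the full shift survives.

Above the threshold, separation forbids a few words, and every admissible sequence is constant or
eventually of the form φ(b) (`eq_const_or_shift_eq_morse`). The tails of b behind a 0 fall strictly
below T within a bounded number N of digits. Each further desubstitution takes 2N + 1 to N, and
nothing is left at N = 0, so only countably many sequences exist. The sequences 0…01010… show that
there are infinitely many.

Near 1/2, inserting 01 after every M digits of an arbitrary sequence already forces separation, and
lengthens words only by the factor 1 + 2/M. -/

/-- The sequence with its first `k` digits removed. -/
def shift (a : ℕ → Fin 2) (k : ℕ) : ℕ → Fin 2 := fun n => a (k + n)

/-- The sequence with the digits 0 and 1 exchanged. -/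
def flip (a : ℕ → Fin 2) : ℕ → Fin 2 := fun n => 1 - a n

theorem shift_shift (a : ℕ → Fin 2) (j k : ℕ) : shift (shift a j) k = shift a (j + k) := by
  funext n; simp [shift, add_assoc]

theorem shift_zero (a : ℕ → Fin 2) : shift a 0 = a := by
  funext n; simp [shift]

theorem flip_shift (a : ℕ → Fin 2) (k : ℕ) : flip (shift a k) = shift (flip a) k := rfl

theorem fin_two_sub_sub (i : Fin 2) : 1 - (1 - i) = i := by revert i; decide

theorem fin_two_cases (i : Fin 2) : i = 0 ∨ i = 1 := by revert i; decide

theorem digit_le_one (i : Fin 2) : ((i : ℕ) : ℝ) ≤ 1 := by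
  have : (i : ℕ) ≤ 1 := by omega
  exact_mod_cast this

theorem digit_flip (i : Fin 2) : (((1 - i : Fin 2) : ℕ) : ℝ) = 1 - ((i : ℕ) : ℝ) := by
  rcases fin_two_cases i with rfl | rfl <;> simp

/-! ### Projections of tails and separation from the overlap -/

section
variable {l : ℝ}

theorem hasSum_geometric_succ (h0 : 0 < l) (h1 : l < 1) :
    HasSum (fun n : ℕ => l ^ (n + 1)) (l / (1 - l)) := by
  have := (hasSum_geometric_of_lt_one h0.le h1).mul_left l
  simpa [pow_succ', div_eq_mul_inv] using this

theorem summable_proj (h0 : 0 < l) (h1 : l < 1) (a : ℕ → Fin 2) :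
    Summable fun n : ℕ => ((a n : ℕ) : ℝ) * l ^ (n + 1) := by
  refine Summable.of_nonneg_of_le (fun n => by positivity) (fun n => ?_)
    (hasSum_geometric_succ h0 h1).summable
  exact mul_le_of_le_one_left (by positivity) (digit_le_one _)

theorem proj_nonneg (h0 : 0 < l) (a : ℕ → Fin 2) : 0 ≤ proj l a :=
  tsum_nonneg fun n => by positivity

theorem proj_le (h0 : 0 < l) (h1 : l < 1) (a : ℕ → Fin 2) : proj l a ≤ l / (1 - l) := by
  rw [← (hasSum_geometric_succ h0 h1).tsum_eq]
  refine (summable_proj h0 h1 a).tsum_le_tsum (fun n => ?_)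
    (hasSum_geometric_succ h0 h1).summable
  exact mul_le_of_le_one_left (by positivity) (digit_le_one _)

theorem proj_flip (h0 : 0 < l) (h1 : l < 1) (a : ℕ → Fin 2) :
    proj l (flip a) = l / (1 - l) - proj l a := by
  unfold proj
  rw [← (hasSum_geometric_succ h0 h1).tsum_eq,
    ← (hasSum_geometric_succ h0 h1).summable.tsum_sub (summable_proj h0 h1 a)]
  congr 1
  funext n
  rw [flip, digit_flip]
  ring

theorem proj_eq_sum_add (h0 : 0 < l) (h1 : l < 1) (a : ℕ → Fin 2) (n : ℕ) :
    proj l a = ∑ i ∈ Finset.range n, ((a i : ℕ) : ℝ) * l ^ (i + 1) + l ^ n * proj l (shift a n) := by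
  unfold proj
  rw [← (summable_proj h0 h1 a).sum_add_tsum_nat_add n, ← tsum_mul_left]
  congr 2
  funext i
  rw [shift, add_comm n i]
  ring

theorem proj_eq_head (h0 : 0 < l) (h1 : l < 1) (a : ℕ → Fin 2) :
    proj l a = ((a 0 : ℕ) : ℝ) * l + l * proj l (shift a 1) := by
  simpa using proj_eq_sum_add h0 h1 a 1

theorem sum_le_proj (h0 : 0 < l) (h1 : l < 1) (a : ℕ → Fin 2) (n : ℕ) :
    ∑ i ∈ Finset.range n, ((a i : ℕ) : ℝ) * l ^ (i + 1) ≤ proj l a := by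
  rw [proj_eq_sum_add h0 h1 a n]
  have := proj_nonneg h0 (shift a n)
  have : 0 ≤ l ^ n * proj l (shift a n) := by positivity
  linarith

theorem proj_sub_of_agree (h0 : 0 < l) (h1 : l < 1) {a b : ℕ → Fin 2} {n : ℕ}
    (h : ∀ i < n, a i = b i) :
    proj l a - proj l b = l ^ n * (proj l (shift a n) - proj l (shift b n)) := by
  rw [proj_eq_sum_add h0 h1 a n, proj_eq_sum_add h0 h1 b n,
    Finset.sum_congr rfl fun i hi => by rw [h i (Finset.mem_range.1 hi)]]
  ring

theorem proj_shift_of_zero (h0 : 0 < l) (h1 : l < 1) {a : ℕ → Fin 2} {n : ℕ} (h : a n = 0) :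
    proj l (shift a n) = l * proj l (shift a (n + 1)) := by
  rw [proj_eq_head h0 h1, shift_shift]
  simp [shift, h]

theorem proj_shift_of_one (h0 : 0 < l) (h1 : l < 1) {a : ℕ → Fin 2} {n : ℕ} (h : a n = 1) :
    proj l (shift a n) = l + l * proj l (shift a (n + 1)) := by
  rw [proj_eq_head h0 h1, shift_shift]
  simp [shift, h]

/-- Every tail that follows a digit 0 has projection at most `1 - ε`. -/
def HalfSep (l ε : ℝ) (a : ℕ → Fin 2) : Prop :=
  ∀ n, a n = 0 → proj l (shift a (n + 1)) ≤ 1 - ε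

/-- At the first difference, one tail is l times a number at most 1 - ε and the other begins with 1,
so is at least l; reflection gives the opposite case. Nothing is assumed of `b`, so it may be an
arbitrary coin sequence. -/
theorem le_abs_proj_sub (h0 : 0 < l) (h1 : l < 1) {ε : ℝ} {a b : ℕ → Fin 2}
    (ha : HalfSep l ε a) (ha' : HalfSep l ε (flip a)) {p : ℕ} (hlt : ∀ i < p, a i = b i)
    (hp : a p ≠ b p) : l ^ (p + 1) * ε ≤ |proj l a - proj l b| := by
  have key : ∀ a b : ℕ → Fin 2, HalfSep l ε a → (∀ i < p, a i = b i) → a p = 0 → b p = 1 →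
      l ^ (p + 1) * ε ≤ proj l b - proj l a := by
    intro a b ha hlt hp hq
    rw [proj_sub_of_agree h0 h1 (fun i hi => (hlt i hi).symm), proj_shift_of_zero h0 h1 hp,
      proj_shift_of_one h0 h1 hq, pow_succ, mul_assoc]
    gcongr
    have h2 := mul_le_mul_of_nonneg_left (ha p hp) h0.le
    have h3 := mul_nonneg h0.le (proj_nonneg h0 (shift b (p + 1)))
    linarith
  rcases fin_two_cases (a p) with h | h <;> rcases fin_two_cases (b p) with h' | h'
  · exact absurd (h.trans h'.symm) hp
  · rw [abs_sub_comm]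
    exact (key a b ha hlt h h').trans (le_abs_self _)
  · refine le_trans ?_ (le_abs_self _)
    have := key (flip a) (flip b) ha' (fun i hi => by simp [flip, hlt i hi]) (by simp [flip, h])
      (by simp [flip, h'])
    rw [proj_flip h0 h1, proj_flip h0 h1] at this
    linarith
  · exact absurd (h.trans h'.symm) hp

theorem exists_first_ne {α : Type*} {a b : ℕ → α} {n : ℕ} (h : a n ≠ b n) :
    ∃ p ≤ n, (∀ i < p, a i = b i) ∧ a p ≠ b p := by
  classical
  have hex : ∃ n, a n ≠ b n := ⟨n, h⟩
  exact ⟨Nat.find hex, Nat.find_min' hex h, fun i hi => not_not.1 (Nat.find_min hex hi),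
    Nat.find_spec hex⟩

theorem eq_of_proj_eq (h0 : 0 < l) (h1 : l < 1) {ε : ℝ} (hε : 0 < ε) {a b : ℕ → Fin 2}
    (ha : HalfSep l ε a) (ha' : HalfSep l ε (flip a)) (h : proj l a = proj l b) : a = b := by
  by_contra hne
  obtain ⟨n, hn⟩ := Function.ne_iff.1 hne
  obtain ⟨p, -, hlt, hp⟩ := exists_first_ne hn
  have := le_abs_proj_sub h0 h1 ha ha' hlt hp
  rw [h, sub_self, abs_zero] at this
  have : 0 < l ^ (p + 1) * ε := by positivity
  linarith

theorem expMap_iterate_of_halfSep (h0 : 1 / 2 < l) (h1 : l < 1) {ε : ℝ} (hε : 0 < ε)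
    {a : ℕ → Fin 2} (ha : HalfSep l ε a) (n : ℕ) :
    (expMap l)^[n] (proj l a) = proj l (shift a n) := by
  have hl : 0 < l := by linarith
  induction n with
  | zero => simp [shift_zero]
  | succ n ih =>
    rw [Function.iterate_succ_apply', ih, expMap]
    rcases fin_two_cases (a n) with h | h
    · have h2 := ha n h
      rw [proj_shift_of_zero hl h1 h, if_pos (by nlinarith)]
      field_simp
    · have h2 := proj_nonneg hl (shift a (n + 1))
      rw [proj_shift_of_one hl h1 h, if_neg (by nlinarith)]
      field_simp
      ring

/-- The two gaps correspond by δ = lε. Both endpoints of the overlap region belong to it because l >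
1/2, so they may be used as test points. -/
theorem mem_wellSepUniqueExp_iff (h0 : 1 / 2 < l) (h1 : l < 1) {x : ℝ} :
    x ∈ wellSepUniqueExp l ↔
      ∃ a, x = proj l a ∧ ∃ ε > 0, HalfSep l ε a ∧ HalfSep l ε (flip a) := by
  have hl : 0 < l := by linarith
  have hl1 : 0 < 1 - l := by linarith
  have hC : l ≤ l ^ 2 / (1 - l) := by rw [le_div_iff₀ hl1]; nlinarith
  have hI : l ^ 2 / (1 - l) = l * (l / (1 - l)) := by ring
  constructor
  · rintro ⟨⟨-, hu⟩, δ, hδ, hx⟩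
    obtain ⟨a, ha⟩ := encard_eq_one.1 hu
    have hxa : x = proj l a := by
      have : a ∈ expansions l x := by rw [ha]; rfl
      exact this
    -- The separation at time n decides which branch of F applies there, and so identifies the orbit
    -- point at time n + 1.
    have horb : ∀ n, (expMap l)^[n] x = proj l (shift a n) ∧
        (a n = 0 → proj l (shift a (n + 1)) ≤ 1 - δ / l) ∧
        (a n = 1 → proj l (shift (flip a) (n + 1)) ≤ 1 - δ / l) := by
      have step : ∀ n, (expMap l)^[n] x = proj l (shift a n) →
          (a n = 0 → proj l (shift a n) ≤ l - δ) ∧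
          (a n = 1 → l ^ 2 / (1 - l) + δ ≤ proj l (shift a n)) := by
        intro n hn
        constructor
        · intro h
          have hup : proj l (shift a n) ≤ l ^ 2 / (1 - l) := by
            rw [proj_shift_of_zero hl h1 h, hI]
            exact mul_le_mul_of_nonneg_left (proj_le hl h1 _) hl.le
          have hlt : proj l (shift a n) < l := by
            by_contra hge
            have := hx n _ ⟨not_lt.1 hge, hup⟩
            rw [hn, dist_self] at this
            linarith
          have := hx n l ⟨le_rfl, hC⟩
          rw [hn, Real.dist_eq, abs_of_neg (by linarith)] at this
          linarith
        · intro h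
          have hlow : l ≤ proj l (shift a n) := by
            rw [proj_shift_of_one hl h1 h]
            have := mul_nonneg hl.le (proj_nonneg hl (shift a (n + 1)))
            linarith
          have hlt : l ^ 2 / (1 - l) < proj l (shift a n) := by
            by_contra hge
            have := hx n _ ⟨hlow, not_lt.1 hge⟩
            rw [hn, dist_self] at this
            linarith
          have := hx n _ ⟨hC, le_rfl⟩
          rw [hn, Real.dist_eq, abs_of_pos (by linarith)] at this
          linarith
      have hsep : ∀ n, (expMap l)^[n] x = proj l (shift a n) →
          (a n = 0 → proj l (shift a (n + 1)) ≤ 1 - δ / l) ∧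
          (a n = 1 → proj l (shift (flip a) (n + 1)) ≤ 1 - δ / l) := by
        intro n hn
        refine ⟨fun h => ?_, fun h => ?_⟩
        · have := (step n hn).1 h
          rw [proj_shift_of_zero hl h1 h] at this
          refine le_of_mul_le_mul_left ?_ hl
          rw [mul_sub, mul_div_cancel₀ _ hl.ne']
          linarith
        · have := (step n hn).2 h
          rw [proj_shift_of_one hl h1 h, hI] at this
          rw [← flip_shift, proj_flip hl h1]
          refine le_of_mul_le_mul_left ?_ hl
          rw [mul_sub l 1, mul_div_cancel₀ _ hl.ne']
          linarith
      intro n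
      refine (fun h => ⟨h, hsep n h⟩) ?_
      induction n with
      | zero => simpa [shift_zero] using hxa
      | succ n ih =>
        have h2 := hsep n ih
        rw [Function.iterate_succ_apply', ih, expMap]
        have hδl : 0 < δ / l := by positivity
        rcases fin_two_cases (a n) with h | h
        · have := h2.1 h
          rw [proj_shift_of_zero hl h1 h, if_pos (by nlinarith)]
          field_simp
        · have h2 := proj_nonneg hl (shift a (n + 1))
          rw [proj_shift_of_one hl h1 h, if_neg (by nlinarith)]
          field_simp
          ring
    refine ⟨a, hxa, δ / l, by positivity, fun n h => (horb n).2.1 h, fun n h => (horb n).2.2 ?_⟩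
    simpa [flip, fin_two_sub_sub] using congrArg (fun i : Fin 2 => 1 - i) h
  · rintro ⟨a, rfl, ε, hε, ha, ha'⟩
    refine ⟨⟨⟨proj_nonneg hl a, proj_le hl h1 a⟩, encard_eq_one.2 ⟨a, ?_⟩⟩, l * ε,
      by positivity, ?_⟩
    · ext b
      simp only [expansions, mem_ofPred_eq, mem_singleton_iff]
      exact ⟨fun h => (eq_of_proj_eq hl h1 hε ha ha' h).symm, fun h => by rw [h]⟩
    · rintro n c ⟨hc1, hc2⟩
      rw [expMap_iterate_of_halfSep h0 h1 hε ha, Real.dist_eq]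
      rcases fin_two_cases (a n) with h | h
      · rw [abs_sub_comm]
        refine le_trans ?_ (le_abs_self _)
        rw [proj_shift_of_zero hl h1 h]
        have := mul_le_mul_of_nonneg_left (ha n h) hl.le
        linarith
      · refine le_trans ?_ (le_abs_self _)
        rw [proj_shift_of_one hl h1 h]
        have h2 := ha' n (by simp [flip, h])
        rw [← flip_shift, proj_flip hl h1] at h2
        have := mul_le_mul_of_nonneg_left h2 hl.le
        linarith

end

/-! ### Masses of cylinders and the local dimension -/

theorem fairCoin_singleton (i : Fin 2) : fairCoin {i} = 2⁻¹ := by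
  unfold fairCoin
  rw [PMF.toMeasure_apply_singleton _ _ (measurableSet_singleton i)]
  simp

theorem infinitePi_fairCoin_cylinder (a : ℕ → Fin 2) (n : ℕ) :
    Measure.infinitePi (fun _ : ℕ => fairCoin) {b | ∀ i < n, b i = a i} = 2⁻¹ ^ n := by
  have : {b : ℕ → Fin 2 | ∀ i < n, b i = a i} =
      Set.pi (Finset.range n : Finset ℕ) fun i => {a i} := by
    ext b; simp
  rw [this, Measure.infinitePi_pi _ fun i _ => measurableSet_singleton _]
  simp [fairCoin_singleton]

section
variable {l : ℝ}

theorem bernoulliConvolution_ball (h0 : 0 < l) (h1 : l < 1) (x r : ℝ) :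
    bernoulliConvolution l (Metric.ball x r) =
      Measure.infinitePi (fun _ : ℕ => fairCoin) {b | |proj l b - x| < r} := by
  rw [bernoulliConvolution, Measure.map_apply (measurable_proj h0 h1) measurableSet_ball]
  rfl

theorem le_bernoulliConvolution_ball (h0 : 0 < l) (h1 : l < 1) (a : ℕ → Fin 2) (n : ℕ) {r : ℝ}
    (hr : l ^ n * (l / (1 - l)) < r) :
    (1 / 2) ^ n ≤ (bernoulliConvolution l (Metric.ball (proj l a) r)).toReal := by
  rw [bernoulliConvolution_ball h0 h1]
  have h : {b : ℕ → Fin 2 | ∀ i < n, b i = a i} ⊆ {b | |proj l b - proj l a| < r} := by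
    intro b hb
    refine lt_of_le_of_lt ?_ hr
    rw [proj_sub_of_agree h0 h1 hb, abs_mul, abs_of_pos (pow_pos h0 n)]
    gcongr
    exact abs_sub_le_of_nonneg_of_le (proj_nonneg h0 _) (proj_le h0 h1 _) (proj_nonneg h0 _)
      (proj_le h0 h1 _)
  have := ENNReal.toReal_mono (measure_ne_top _ _)
    (measure_mono (μ := Measure.infinitePi (fun _ : ℕ => fairCoin)) h)
  rw [infinitePi_fairCoin_cylinder] at this
  simpa using this

/-- A sequence that leaves the cylinder of `a` at a place p < n projects at distance at least
l^(p+1) ε ≥ l^n ε, outside the ball. -/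
theorem bernoulliConvolution_ball_le (h0 : 0 < l) (h1 : l < 1) {ε : ℝ} (hε : 0 < ε)
    {a : ℕ → Fin 2} (ha : HalfSep l ε a) (ha' : HalfSep l ε (flip a)) (n : ℕ) {r : ℝ}
    (hr : r ≤ l ^ n * ε) :
    (bernoulliConvolution l (Metric.ball (proj l a) r)).toReal ≤ (1 / 2) ^ n := by
  rw [bernoulliConvolution_ball h0 h1]
  have h : {b | |proj l b - proj l a| < r} ⊆ {b : ℕ → Fin 2 | ∀ i < n, b i = a i} := by
    intro b hb
    by_contra hne
    simp only [mem_ofPred_eq, not_forall] at hne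
    obtain ⟨i, hi, hne⟩ := hne
    obtain ⟨p, hpi, hlt, hp⟩ := exists_first_ne (Ne.symm hne)
    have h2 := le_abs_proj_sub h0 h1 ha ha' hlt hp
    rw [abs_sub_comm] at h2
    have h3 : l ^ n ≤ l ^ (p + 1) := pow_le_pow_of_le_one h0.le h1.le (by omega)
    have h4 := mul_le_mul_of_nonneg_right h3 hε.le
    have h5 : |proj l b - proj l a| < r := hb
    linarith
  have := ENNReal.toReal_mono (measure_ne_top _ _)
    (measure_mono (μ := Measure.infinitePi (fun _ : ℕ => fairCoin)) h)
  rw [infinitePi_fairCoin_cylinder] at this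
  simpa using this

theorem hasLocalDim_of_power_bounds {μ : Measure ℝ} {x s c C r₀ : ℝ} (hc : 0 < c) (hr₀ : 0 < r₀)
    (hlow : ∀ r, 0 < r → r < r₀ → c * r ^ s ≤ (μ (Metric.ball x r)).toReal)
    (hup : ∀ r, 0 < r → r < r₀ → (μ (Metric.ball x r)).toReal ≤ C * r ^ s) :
    HasLocalDim μ x s := by
  have hlog : Tendsto (fun r : ℝ => Real.log r) (𝓝[>] 0) atBot := Real.tendsto_log_nhdsGT_zero
  have hlim : ∀ A : ℝ, Tendsto (fun r : ℝ => A / Real.log r + s) (𝓝[>] 0) (𝓝 s) := by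
    intro A
    simpa using (hlog.const_div_atBot A).add_const s
  have hmem : ∀ᶠ r : ℝ in 𝓝[>] 0, 0 < r ∧ r < r₀ ∧ r < 1 := by
    filter_upwards [Ioo_mem_nhdsGT hr₀, Ioo_mem_nhdsGT one_pos] with r h h'
    exact ⟨h.1, h.2, h'.2⟩
  have hC : 0 < C := by
    have h := (hlow (r₀ / 2) (by linarith) (by linarith)).trans
      (hup (r₀ / 2) (by linarith) (by linarith))
    have h2 : 0 < (r₀ / 2) ^ s := Real.rpow_pos_of_pos (by linarith) s
    exact hc.trans_le (le_of_mul_le_mul_right h h2)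
  -- Since log r < 0, the upper bound on the mass gives the lower bound on the quotient, and
  -- conversely.
  refine tendsto_of_tendsto_of_tendsto_of_le_of_le' (hlim (Real.log C)) (hlim (Real.log c)) ?_ ?_
  · filter_upwards [hmem] with r ⟨h0, h1, h2⟩
    have hl : Real.log r < 0 := Real.log_neg h0 h2
    have hp : 0 < r ^ s := Real.rpow_pos_of_pos h0 s
    have hm : 0 < (μ (Metric.ball x r)).toReal := lt_of_lt_of_le (by positivity) (hlow r h0 h1)
    rw [le_div_iff_of_neg hl, add_mul, div_mul_cancel₀ _ hl.ne, ← Real.log_rpow h0,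
      ← Real.log_mul hC.ne' hp.ne']
    exact Real.log_le_log hm (hup r h0 h1)
  · filter_upwards [hmem] with r ⟨h0, h1, h2⟩
    have hl : Real.log r < 0 := Real.log_neg h0 h2
    have hp : 0 < r ^ s := Real.rpow_pos_of_pos h0 s
    rw [div_le_iff_of_neg hl, add_mul, div_mul_cancel₀ _ hl.ne, ← Real.log_rpow h0,
      ← Real.log_mul hc.ne' hp.ne']
    exact Real.log_le_log (by positivity) (hlow r h0 h1)

theorem abs_log_pos (h0 : 0 < l) (h1 : l < 1) : 0 < |Real.log l| :=
  abs_pos.2 (Real.log_neg h0 h1).ne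

theorem simDim_pos (h0 : 0 < l) (h1 : l < 1) : 0 < simDim l :=
  div_pos (Real.log_pos one_lt_two) (abs_log_pos h0 h1)

theorem rpow_simDim (h0 : 0 < l) (h1 : l < 1) : l ^ simDim l = 1 / 2 := by
  have hl := Real.log_neg h0 h1
  have hl' := hl.ne
  rw [Real.rpow_def_of_pos h0, simDim, abs_of_neg hl,
    show Real.log l * (Real.log 2 / -Real.log l) = -Real.log 2 by field_simp, Real.exp_neg,
    Real.exp_log two_pos, one_div]

theorem pow_rpow_simDim (h0 : 0 < l) (h1 : l < 1) (n : ℕ) : (l ^ n) ^ simDim l = (1 / 2) ^ n := by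
  rw [← Real.rpow_natCast, ← Real.rpow_mul h0.le, mul_comm, Real.rpow_mul h0.le,
    rpow_simDim h0 h1, Real.rpow_natCast]

theorem one_lt_simDim (h0 : 1 / 2 < l) (h1 : l < 1) : 1 < simDim l := by
  have hl0 : 0 < l := by linarith
  have hl := Real.log_neg hl0 h1
  rw [simDim, one_lt_div (abs_log_pos hl0 h1), abs_of_neg hl, ← Real.log_inv]
  refine Real.log_lt_log (by positivity) ?_
  rw [inv_lt_comm₀ hl0 two_pos]
  linarith

theorem hasLocalDim_of_halfSep (h0 : 0 < l) (h1 : l < 1) {ε : ℝ} (hε : 0 < ε)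
    {a : ℕ → Fin 2} (ha : HalfSep l ε a) (ha' : HalfSep l ε (flip a)) :
    HasLocalDim (bernoulliConvolution l) (proj l a) (simDim l) := by
  have hs := simDim_pos h0 h1
  have hl1 : 0 < 1 - l := by linarith
  -- Any number above l/(1-l) would do: the lower ball estimate needs a strict inequality. The
  -- factors 1/2 and 2 below pay for rounding r to a power of l.
  set K : ℝ := 1 / (1 - l) with hK
  have hKpos : 0 < K := by positivity
  have hlK : l / (1 - l) < K := by rw [hK]; gcongr
  refine hasLocalDim_of_power_bounds (c := 1 / 2 * (K⁻¹) ^ simDim l)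
    (C := 2 * (ε⁻¹) ^ simDim l) (r₀ := min K ε) (by positivity) (lt_min hKpos hε) ?_ ?_
  · intro r hr hr0
    have hrK : r < K := hr0.trans_le (min_le_left _ _)
    obtain ⟨n, hn, hn'⟩ := exists_nat_pow_near_of_lt_one (x := r / K) (y := l) (by positivity)
      ((div_le_one hKpos).2 hrK.le) h0 h1
    have hn2 := (lt_div_iff₀ hKpos).1 hn
    refine le_trans ?_ (le_bernoulliConvolution_ball h0 h1 a (n + 1) (lt_trans ?_ hn2))
    · have := Real.rpow_le_rpow (by positivity) hn' hs.le
      rw [pow_rpow_simDim h0 h1, div_eq_mul_inv r, Real.mul_rpow hr.le (by positivity)] at this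
      rw [pow_succ]
      linarith
    · gcongr
  · intro r hr hr0
    have hrK : r < ε := hr0.trans_le (min_le_right _ _)
    obtain ⟨n, hn, hn'⟩ := exists_nat_pow_near_of_lt_one (x := r / ε) (y := l) (by positivity)
      ((div_le_one hε).2 hrK.le) h0 h1
    have hn2 := (div_le_iff₀ hε).1 hn'
    refine (bernoulliConvolution_ball_le h0 h1 hε ha ha' n hn2).trans ?_
    have := Real.rpow_le_rpow (by positivity) hn.le hs.le
    rw [pow_rpow_simDim h0 h1, div_eq_mul_inv r, Real.mul_rpow hr.le (by positivity), pow_succ]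
      at this
    linarith

/-! ### Hausdorff dimension from a coding -/

/-- A coding of the full shift whose code words of length `n` occupy `ρ n` digits gives a lower
bound for the Hausdorff dimension. -/
theorem le_dimH_of_coding (h0 : 0 < l) (h1 : l < 1) {ε ρ : ℝ} (hε : 0 < ε) (hρ : 0 < ρ)
    {E : (ℕ → Fin 2) → ℕ → Fin 2} (hE : ∀ c, HalfSep l ε (E c) ∧ HalfSep l ε (flip (E c)))
    (hcode : ∀ c c' (i : ℕ), c i ≠ c' i → ∃ p : ℕ, (p : ℝ) ≤ ρ * i ∧ E c p ≠ E c' p) :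
    ENNReal.ofReal (simDim l / ρ) ≤ dimH (range fun c => proj l (E c)) := by
  set r : ℝ := simDim l / ρ with hr
  have hr0 : 0 < r := div_pos (simDim_pos h0 h1) hρ
  have hlr : l ^ (ρ * r) = 1 / 2 := by
    rw [hr, mul_div_cancel₀ _ hρ.ne', rpow_simDim h0 h1]
  -- If c and c' first differ at i, their binary values differ by at most 2^(-i) = (l^(ρ i))^r,
  -- while their projections differ by at least l^(ρ i) · lε.
  have hbound : ∀ c c', |Real.ofDigits c - Real.ofDigits c'| ≤
      ((l * ε)⁻¹) ^ r * |proj l (E c) - proj l (E c')| ^ r := by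
    intro c c'
    rcases eq_or_ne c c' with rfl | hne
    · simp only [sub_self, abs_zero]; positivity
    obtain ⟨i, hi⟩ := Function.ne_iff.1 hne
    obtain ⟨i, -, hlt, hi⟩ := exists_first_ne hi
    obtain ⟨p, hp, hpne⟩ := hcode c c' i hi
    obtain ⟨q, hqp, hlt', hq⟩ := exists_first_ne hpne
    have h2 := le_abs_proj_sub h0 h1 (hE c).1 (hE c).2 hlt' hq
    have h3 : |Real.ofDigits c - Real.ofDigits c'| ≤ (1 / 2) ^ i := by
      simpa using Real.abs_ofDigits_sub_ofDigits_le hlt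
    refine h3.trans ?_
    rw [← Real.mul_rpow (by positivity) (abs_nonneg _)]
    have h4 : l ^ (ρ * i) ≤ (l * ε)⁻¹ * |proj l (E c) - proj l (E c')| := by
      rw [inv_mul_eq_div, le_div_iff₀ (by positivity)]
      refine le_trans ?_ h2
      rw [pow_succ, mul_assoc]
      gcongr
      rw [← Real.rpow_natCast]
      refine Real.rpow_le_rpow_of_exponent_ge h0 h1.le (le_trans ?_ hp)
      exact_mod_cast hqp
    refine le_trans (le_of_eq ?_) (Real.rpow_le_rpow (by positivity) h4 hr0.le)
    rw [← Real.rpow_mul h0.le, mul_right_comm, Real.rpow_mul h0.le, hlr, Real.rpow_natCast]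
  set x : (ℕ → Fin 2) → ℝ := fun c => proj l (E c) with hx
  -- The Hölder bound makes the binary value independent of the chosen code, so it is a function on
  -- the range, with image covering [0, 1].
  set f : ℝ → ℝ := fun y => Real.ofDigits (Function.invFun x y) with hf
  have hfx : ∀ c, f (x c) = Real.ofDigits c := by
    intro c
    have h2 := hbound (Function.invFun x (x c)) c
    have h3 : proj l (E (Function.invFun x (x c))) = proj l (E c) :=
      Function.invFun_eq (f := x) ⟨c, rfl⟩
    rw [h3, sub_self, abs_zero, Real.zero_rpow hr0.ne', mul_zero] at h2
    exact sub_eq_zero.1 (abs_nonpos_iff.1 h2)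
  have hhold : HolderOnWith (((l * ε)⁻¹) ^ r).toNNReal r.toNNReal f (range x) := by
    rintro _ ⟨c, rfl⟩ _ ⟨c', rfl⟩
    rw [hfx, hfx, edist_dist, edist_dist, Real.dist_eq, Real.dist_eq, Real.coe_toNNReal _ hr0.le,
      ENNReal.ofReal_rpow_of_nonneg (abs_nonneg _) hr0.le, ← ENNReal.ofReal,
      ← ENNReal.ofReal_mul (by positivity)]
    exact ENNReal.ofReal_le_ofReal (hbound c c')
  have hdim := hhold.dimH_image_le (Real.toNNReal_pos.2 hr0)
  have hsurj : Icc (0 : ℝ) 1 ⊆ f '' range x := by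
    intro y hy
    obtain ⟨c, -, hc⟩ := Real.ofDigits_SurjOn one_lt_two hy
    exact ⟨x c, ⟨c, rfl⟩, by rw [hfx, hc]⟩
  have hone : dimH (Icc (0 : ℝ) 1) = 1 := by
    rw [Real.dimH_of_nonempty_interior (by simp)]
    simp
  have h5 : (1 : ENNReal) ≤ dimH (range x) / ENNReal.ofReal r :=
    hone ▸ (dimH_mono hsurj).trans hdim
  have h6 := (ENNReal.le_div_iff_mul_le (Or.inl (ENNReal.ofReal_pos.2 hr0).ne')
    (Or.inl ENNReal.ofReal_ne_top)).1 h5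
  simpa using h6

end

/-! ### The Thue–Morse substitution and the lexicographic order -/

/-- Among the first `N` digits, `t` is lexicographically at most `s`. -/
def LexLE (N : ℕ) (t s : ℕ → Fin 2) : Prop := ∀ j < N, (∀ i < j, t i = s i) → t j ≤ s j

/-- The Thue–Morse substitution 0 → 01, 1 → 10. -/
def morse (b : ℕ → Fin 2) : ℕ → Fin 2 := fun n => if n % 2 = 0 then b (n / 2) else 1 - b (n / 2)

theorem morse_even (b : ℕ → Fin 2) (n : ℕ) : morse b (2 * n) = b n := by
  simp [morse]

theorem morse_odd (b : ℕ → Fin 2) (n : ℕ) : morse b (2 * n + 1) = 1 - b n := by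
  have h : (2 * n + 1) / 2 = n := by omega
  simp [morse, h]

theorem flip_morse (b : ℕ → Fin 2) : flip (morse b) = morse (flip b) := by
  funext n
  simp only [flip, morse]
  split_ifs <;> rfl

theorem shift_morse (b : ℕ → Fin 2) (k : ℕ) : shift (morse b) (2 * k) = morse (shift b k) := by
  funext n
  have h1 : (2 * k + n) % 2 = n % 2 := by omega
  have h2 : (2 * k + n) / 2 = k + n / 2 := by omega
  simp only [shift, morse, h1, h2]

theorem exists_eq_two_mul_or (n : ℕ) : ∃ m, n = 2 * m ∨ n = 2 * m + 1 :=
  ⟨n / 2, by omega⟩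

/-- The Thue–Morse sequence as a sequence of binary digits. -/
def morseSeq : ℕ → Fin 2 := fun n => ⟨thueMorse n, Nat.mod_lt _ two_pos⟩

theorem morse_morseSeq : morse morseSeq = morseSeq := by
  funext n
  obtain ⟨m, rfl | rfl⟩ := exists_eq_two_mul_or n
  · rw [morse_even]
    rcases Nat.eq_zero_or_pos m with rfl | hm
    · rfl
    · refine Fin.ext ?_
      have := Nat.digits_add_two_add_one 0 (2 * m - 1)
      rw [show 2 * m - 1 + 1 = 2 * m by omega] at this
      simp [morseSeq, thueMorse, this]
  · rw [morse_odd]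
    refine Fin.ext ?_
    have := Nat.digits_add_two_add_one 0 (2 * m)
    have h2 : (2 * m + 1) / 2 = m := by omega
    simp only [morseSeq, thueMorse, this, h2]
    rw [List.sum_cons, Fin.sub_def]
    simp
    omega

theorem morseSeq_zero : morseSeq 0 = 0 := rfl

/-- The Thue–Morse sequence without its first digit. -/
def morseTail : ℕ → Fin 2 := shift morseSeq 1

theorem morseTail_eq : morseTail = shift (morse morseSeq) 1 := by rw [morse_morseSeq, morseTail]

theorem morseTail_zero : morseTail 0 = 1 := by
  have := morse_odd morseSeq 0
  rw [morseTail_eq]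
  simpa [shift, morseSeq_zero] using this

theorem morseTail_succ (n : ℕ) : morseTail (n + 1) = morse morseTail n := by
  rw [morseTail, ← shift_morse, morse_morseSeq]
  simp [shift]
  congr 1
  omega

theorem morseTail_odd (n : ℕ) : morseTail (2 * n + 1) = morseTail n := by
  rw [morseTail_succ, morse_even]

theorem morseTail_even (n : ℕ) : morseTail (2 * n + 2) = 1 - morseTail n := by
  rw [morseTail_succ, morse_odd]

theorem morseTail_prefix : morseTail 1 = 1 ∧ morseTail 2 = 0 ∧ morseTail 3 = 1 ∧
    morseTail 4 = 0 ∧ morseTail 5 = 0 := by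
  have h0 := morseTail_zero
  have h1 : morseTail 1 = 1 := (morseTail_odd 0).trans h0
  have h2 : morseTail 2 = 0 := by rw [morseTail_even 0, h0]; rfl
  have h3 : morseTail 3 = 1 := (morseTail_odd 1).trans h1
  have h4 : morseTail 4 = 0 := by rw [morseTail_even 1, h1]; rfl
  have h5 : morseTail 5 = 0 := (morseTail_odd 2).trans h2
  exact ⟨h1, h2, h3, h4, h5⟩

/-- Every tail that follows a digit 0 is lexicographically at most the Thue–Morse tail, within
the first `N` digits. -/
def MorseBdd (N : ℕ) (a : ℕ → Fin 2) : Prop :=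
  ∀ n, a n = 0 → LexLE N (shift a (n + 1)) morseTail

/-- Every tail that follows a digit 0 becomes lexicographically smaller than the Thue–Morse tail
within the first `N` digits. -/
def MorseStrict (N : ℕ) (a : ℕ → Fin 2) : Prop :=
  ∀ n, a n = 0 → ¬ LexLE N morseTail (shift a (n + 1))

/-- A failure exhibits the first difference, which settles the comparison at every length. -/
theorem lexLE_of_not_lexLE {M N : ℕ} {t s : ℕ → Fin 2} (h : ¬ LexLE N s t) : LexLE M t s := by
  simp only [LexLE, not_forall, not_le] at h
  obtain ⟨j, -, hj, hlt⟩ := h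
  intro i _ hi
  rcases lt_trichotomy i j with hij | rfl | hij
  · exact (hj i hij).ge
  · exact hlt.le
  · exact absurd (hi j hij) hlt.ne

/-- The substitution followed by the removal of the initial digit preserves the lexicographic
order. -/
theorem lexLE_cons_morse_iff {N : ℕ} {t s t' s' : ℕ → Fin 2} (ht : t' 0 = s' 0)
    (ht' : ∀ n, t' (n + 1) = morse t n) (hs' : ∀ n, s' (n + 1) = morse s n) :
    LexLE (2 * N + 1) t' s' ↔ LexLE N t s := by
  constructor
  · intro h j hj hi
    have := h (2 * j + 1) (by omega) ?_
    · rwa [ht', hs', morse_even, morse_even] at this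
    · rintro (_ | i) hij
      · exact ht
      · rw [ht', hs']
        have := hi (i / 2) (by omega)
        simp only [morse, this]
  · rintro h (_ | j) hj hi
    · exact ht.le
    · have hag : ∀ i < j, morse t i = morse s i := fun i hij => by
        rw [← ht', ← hs']; exact hi _ (by omega)
      rw [ht', hs']
      obtain ⟨m, rfl | rfl⟩ := exists_eq_two_mul_or j
      · rw [morse_even, morse_even]
        refine h m (by omega) fun i him => ?_
        rw [← morse_even t, ← morse_even s]
        exact hag _ (by omega)
      -- The second digit of a block is determined by the first, so it cannot be the first
      -- difference.
      · have := hag (2 * m) (by omega)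
        rw [morse_even, morse_even] at this
        rw [morse_odd, morse_odd, this]

theorem shift_morse_succ (b : ℕ → Fin 2) (m n : ℕ) :
    shift (morse b) (2 * m + 1) (n + 1) = morse (shift b (m + 1)) n := by
  rw [← shift_morse]
  simp only [shift]
  congr 1
  omega

theorem shift_morse_odd_zero (b : ℕ → Fin 2) (m : ℕ) :
    shift (morse b) (2 * m + 1) 0 = 1 - b m := morse_odd b m

/-- A 0 that opens a block is followed by 1φ(tail), to be compared with T = 1φ(T). A 0 that closes a
block is followed by a whole block 01 or 10, which is below the initial 11 of T. -/
theorem MorseBdd.morse {N : ℕ} {b : ℕ → Fin 2} (h : MorseBdd N b) :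
    MorseBdd (2 * N + 1) (morse b) := by
  intro n hn
  obtain ⟨m, rfl | rfl⟩ := exists_eq_two_mul_or n
  · rw [morse_even] at hn
    refine (lexLE_cons_morse_iff ?_ (shift_morse_succ b m) morseTail_succ).2 (h m hn)
    rw [shift_morse_odd_zero, hn, morseTail_zero]
    rfl
  · rw [show 2 * m + 1 + 1 = 2 * (m + 1) by ring, shift_morse]
    intro j hj hi
    have h0 : BernoulliConv.morse (shift b (m + 1)) 0 = b (m + 1) := by simp [BernoulliConv.morse, shift]
    have h1 : BernoulliConv.morse (shift b (m + 1)) 1 = 1 - b (m + 1) := by simp [BernoulliConv.morse, shift]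
    rcases j with _ | _ | j
    · rw [morseTail_zero]; exact Fin.le_last _
    · rw [zero_add, morseTail_prefix.1]; exact Fin.le_last _
    · have e0 := hi 0 (by omega)
      have e1 := hi 1 (by omega)
      rw [h0, morseTail_zero] at e0
      rw [h1, morseTail_prefix.1, e0] at e1
      exact absurd e1 (by decide)

theorem MorseStrict.of_morse {N : ℕ} {b : ℕ → Fin 2} (h : MorseStrict (2 * N + 1) (morse b)) :
    MorseStrict N b := by
  intro n hn hle
  refine h (2 * n) (by rwa [morse_even]) ?_
  refine (lexLE_cons_morse_iff ?_ morseTail_succ (shift_morse_succ b n)).2 hle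
  rw [shift_morse_odd_zero, hn, morseTail_zero]
  rfl

theorem MorseStrict.shift {N : ℕ} {a : ℕ → Fin 2} (h : MorseStrict N a) (k : ℕ) :
    MorseStrict N (shift a k) := by
  intro n hn
  rw [shift_shift, ← add_assoc]
  exact h (k + n) hn

theorem MorseStrict.morseBdd {M N : ℕ} {a : ℕ → Fin 2} (h : MorseStrict M a) : MorseBdd N a :=
  fun n hn => lexLE_of_not_lexLE (h n hn)

/-! ### Desubstitution and countability -/

/-- The words 111, 11011 and 110101 do not follow a digit 0. -/
theorem morseBdd_six_iff {a : ℕ → Fin 2} : MorseBdd 6 a ↔ ∀ n, a n = 0 → a (n + 1) = 1 →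
    a (n + 2) = 1 → a (n + 3) = 0 ∧ (a (n + 4) = 1 → a (n + 5) = 0 ∧ a (n + 6) = 0) := by
  obtain ⟨t1, t2, t3, t4, t5⟩ := morseTail_prefix
  have t0 := morseTail_zero
  constructor
  · intro h n h0 h1 h2
    have hl := h n h0
    have e : ∀ i, shift a (n + 1) i = a (n + (i + 1)) := fun i => by
      simp only [shift]; congr 1; omega
    have h3 : a (n + 3) = 0 := by
      have := hl 2 (by omega) (by intro i hi; interval_cases i <;> simp_all)
      rw [e, t2] at this
      exact Fin.le_zero_iff.1 this
    refine ⟨h3, fun h4 => ?_⟩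
    have h5 : a (n + 5) = 0 := by
      have := hl 4 (by omega) (by intro i hi; interval_cases i <;> simp_all)
      rw [e, t4] at this
      exact Fin.le_zero_iff.1 this
    refine ⟨h5, ?_⟩
    have := hl 5 (by omega) (by intro i hi; interval_cases i <;> simp_all)
    rw [e, t5] at this
    exact Fin.le_zero_iff.1 this
  · intro h n h0 j hj hi
    have e : ∀ i, shift a (n + 1) i = a (n + (i + 1)) := fun i => by
      simp only [shift]; congr 1; omega
    simp only [e] at hi ⊢
    interval_cases j
    · rw [t0]; exact Fin.le_last _
    · rw [t1]; exact Fin.le_last _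
    · have := h n h0 ((hi 0 (by omega)).trans t0) ((hi 1 (by omega)).trans t1)
      exact (this.1.trans t2.symm).le
    · rw [t3]; exact Fin.le_last _
    · have := h n h0 ((hi 0 (by omega)).trans t0) ((hi 1 (by omega)).trans t1)
      exact ((this.2 ((hi 3 (by omega)).trans t3)).1.trans t4.symm).le
    · have := h n h0 ((hi 0 (by omega)).trans t0) ((hi 1 (by omega)).trans t1)
      exact ((this.2 ((hi 3 (by omega)).trans t3)).2.trans t5.symm).le

/-- After 011 a 0 must follow. The next digit either doubles this 0 or is a 1 that must be followed
by 00. So successive doubled letters are 2 or 4 places apart, and cutting through their middles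
leaves only blocks 01 and 10. Without a doubled letter after a change of digit, the sequence is
constant or eventually alternating, hence eventually φ of a constant. -/
theorem eq_const_or_shift_eq_morse {a : ℕ → Fin 2} (h : MorseBdd 6 a) (h' : MorseBdd 6 (flip a)) :
    (∀ n, a n = a 0) ∨ ∃ k b, shift a k = morse b := by
  rw [morseBdd_six_iff] at h h'
  have h2 : ∀ n, a n = 1 → a (n + 1) = 0 → a (n + 2) = 0 →
      a (n + 3) = 1 ∧ (a (n + 4) = 0 → a (n + 5) = 1 ∧ a (n + 6) = 1) := by
    have f : ∀ n, (flip a n = 0 ↔ a n = 1) ∧ (flip a n = 1 ↔ a n = 0) := by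
      intro n
      rcases fin_two_cases (a n) with hn | hn <;> simp [flip, hn]
    simpa only [(f _).1, (f _).2] using h'
  have hmorse : ∀ k, (∀ j, a (k + 2 * j) ≠ a (k + 2 * j + 1)) → ∃ k b, shift a k = morse b := by
    intro k hk
    refine ⟨k, fun j => a (k + 2 * j), funext fun n => ?_⟩
    obtain ⟨m, rfl | rfl⟩ := exists_eq_two_mul_or n
    · rw [morse_even]; rfl
    · rw [morse_odd]
      have := hk m
      simp only [shift, ← add_assoc]
      generalize a (k + 2 * m) = u at *
      generalize a (k + 2 * m + 1) = v at *
      revert u v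
      decide
  have ne_iff : ∀ u v : Fin 2, u ≠ v ↔ (u = 0 ∧ v = 1) ∨ (u = 1 ∧ v = 0) := by decide
  have step : ∀ e, a e ≠ a (e + 1) → a (e + 1) = a (e + 2) → a (e + 2) ≠ a (e + 3) ∧
      ((a (e + 2) ≠ a (e + 3) ∧ a (e + 3) = a (e + 4)) ∨
        (a (e + 4) ≠ a (e + 5) ∧ a (e + 5) = a (e + 6))) := by
    intro e h0 h1
    have h3 := h e
    have h4 := h2 e
    grind
  have run : ∀ j e, a e ≠ a (e + 1) → a (e + 1) = a (e + 2) →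
      a (e + 2 + 2 * j) ≠ a (e + 2 + 2 * j + 1) := by
    intro j
    induction j using Nat.strong_induction_on with
    | _ j ih =>
      intro e h0 h1
      obtain ⟨h3, h4⟩ := step e h0 h1
      rcases j with _ | j
      · exact h3
      rcases h4 with h4 | h4
      · have := ih j (by omega) (e + 2) h4.1 h4.2
        rwa [show e + 2 + 2 + 2 * j = e + 2 + 2 * (j + 1) by ring] at this
      rcases j with _ | j
      · exact h4.1
      · have := ih j (by omega) (e + 4) h4.1 h4.2
        rwa [show e + 4 + 2 + 2 * j = e + 2 + 2 * (j + 1 + 1) by ring] at this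
  by_cases hd : ∃ e, a e ≠ a (e + 1) ∧ a (e + 1) = a (e + 2)
  · obtain ⟨e, h0, h1⟩ := hd
    exact Or.inr (hmorse (e + 2) fun j => run j e h0 h1)
  simp only [not_exists, not_and] at hd
  by_cases hc : ∃ e, a e ≠ a (e + 1)
  · obtain ⟨e, he⟩ := hc
    refine Or.inr (hmorse e fun j => ?_)
    have : ∀ i, a (e + i) ≠ a (e + i + 1) := by
      intro i
      induction i with
      | zero => exact he
      | succ i ih => exact hd _ ih
    exact this _
  · simp only [not_exists, not_not] at hc
    refine Or.inl fun n => ?_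
    induction n with
    | zero => rfl
    | succ n ih => rw [← hc, ih]

theorem countable_shift_mem {Y : Set (ℕ → Fin 2)} (hY : Y.Countable) (k : ℕ) :
    {a | shift a k ∈ Y}.Countable := by
  have : InjOn (fun a : ℕ → Fin 2 => ((fun i : Fin k => a i), shift a k)) {a | shift a k ∈ Y} := by
    intro a _ b _ hab
    obtain ⟨h1, h2⟩ := Prod.mk.inj hab
    funext n
    rcases lt_or_ge n k with hn | hn
    · exact congrFun h1 ⟨n, hn⟩
    · have := congrFun h2 (n - k)
      simpa [shift, Nat.add_sub_cancel' hn] using this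
  refine MapsTo.countable_of_injOn (t := univ ×ˢ Y) (fun a ha => mk_mem_prod (mem_univ _) ha) this ?_
  exact countable_univ.prod hY

theorem countable_of_shift_eq_morse {X Y : Set (ℕ → Fin 2)} (hY : Y.Countable)
    (h : ∀ a ∈ X, MorseBdd 6 a ∧ MorseBdd 6 (flip a))
    (hXY : ∀ a ∈ X, ∀ k b, shift a k = morse b → b ∈ Y) : X.Countable := by
  have hc : (range fun i : Fin 2 => fun _ : ℕ => i).Countable := countable_range _
  refine (hc.union (countable_iUnion fun k => countable_shift_mem (hY.image morse) k)).mono ?_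
  intro a ha
  rcases eq_const_or_shift_eq_morse (h a ha).1 (h a ha).2 with h1 | ⟨k, b, h1⟩
  · exact Or.inl ⟨a 0, funext fun n => (h1 n).symm⟩
  · exact Or.inr (mem_iUnion.2 ⟨k, b, hXY a ha k b h1, h1.symm⟩)

/-- Strictness at any length implies the bound at length 6, so desubstitution applies and lowers n.
At length 0 strictness forbids the digit 0, in `a` and in its reflection alike. -/
theorem countable_morseStrict (n : ℕ) :
    {a | MorseStrict (2 ^ n - 1) a ∧ MorseStrict (2 ^ n - 1) (flip a)}.Countable := by
  induction n with
  | zero =>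
    convert! countable_empty
    refine eq_empty_of_forall_notMem fun a ha => ?_
    rcases fin_two_cases (a 0) with h | h
    · exact ha.1 0 h fun j hj => by simp at hj
    · exact ha.2 0 (by simp [flip, h]) fun j hj => by simp at hj
  | succ n ih =>
    have e : 2 ^ (n + 1) - 1 = 2 * (2 ^ n - 1) + 1 := by
      have := Nat.one_le_two_pow (n := n)
      rw [pow_succ]
      omega
    rw [e]
    refine countable_of_shift_eq_morse ih (fun a ha => ⟨ha.1.morseBdd, ha.2.morseBdd⟩) ?_
    intro a ha k b hb
    refine ⟨.of_morse (hb ▸ ha.1.shift k), .of_morse ?_⟩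
    rw [← flip_morse, ← hb, flip_shift]
    exact ha.2.shift k
-- Positive dimension below the Komornik–Loreti threshold
section
variable {l : ℝ}

theorem range_subset_wellSepUniqueExp (h0 : 1 / 2 < l) (h1 : l < 1) {ε : ℝ} (hε : 0 < ε)
    {E : (ℕ → Fin 2) → ℕ → Fin 2} (hE : ∀ c, HalfSep l ε (E c) ∧ HalfSep l ε (flip (E c))) :
    (range fun c => proj l (E c)) ⊆ wellSepUniqueExp l := by
  rintro _ ⟨c, rfl⟩
  exact (mem_wellSepUniqueExp_iff h0 h1).2 ⟨E c, rfl, ε, hε, hE c⟩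

/-- The block of a digit b contributes b(l^(2k+1) - l^(2k+2)) + l^(2k+2). The passage to l² matters
because below the golden ratio l² ≤ 1/2, where projection respects the lexicographic order. -/
theorem proj_morse (h0 : 0 < l) (h1 : l < 1) (b : ℕ → Fin 2) :
    proj l (morse b) = (1 - l) / l * proj (l ^ 2) b + l ^ 2 / (1 - l ^ 2) := by
  have h0' : 0 < l ^ 2 := by positivity
  have h1' : l ^ 2 < 1 := by nlinarith
  have hb := (summable_proj h0' h1' b).hasSum
  set f : ℕ → ℝ := fun n => ((morse b n : ℕ) : ℝ) * l ^ (n + 1) with hf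
  have he : HasSum (fun k => f (2 * k)) (l⁻¹ * proj (l ^ 2) b) := by
    rw [show (fun k => f (2 * k)) = fun k => l⁻¹ * (((b k : ℕ) : ℝ) * (l ^ 2) ^ (k + 1)) from ?_]
    · exact hb.mul_left l⁻¹
    funext k
    simp only [hf]
    rw [morse_even, ← pow_mul, show 2 * (k + 1) = 2 * k + 1 + 1 by ring, pow_succ l (2 * k + 1)]
    field_simp
  have ho : HasSum (fun k => f (2 * k + 1)) (l ^ 2 / (1 - l ^ 2) - proj (l ^ 2) b) := by
    rw [show (fun k => f (2 * k + 1)) =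
      fun k => (l ^ 2) ^ (k + 1) - ((b k : ℕ) : ℝ) * (l ^ 2) ^ (k + 1) from ?_]
    · exact (hasSum_geometric_succ h0' h1').sub hb
    funext k
    simp only [hf]
    rw [morse_odd, digit_flip, ← pow_mul]
    ring
  have h := (he.even_add_odd ho).tsum_eq
  rw [show proj l (morse b) = ∑' n, f n from rfl, h]
  generalize l ^ 2 / (1 - l ^ 2) = u
  field_simp
  ring

theorem proj_lt_proj {m : ℝ} (h0 : 0 < l) (hlm : l < m) (h1 : m < 1) {a : ℕ → Fin 2}
    (ha : a 0 = 1) : proj l a < proj m a := by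
  refine Summable.tsum_lt_tsum (i := 0) (fun n => ?_) ?_ (summable_proj h0 (hlm.trans h1) a)
    (summable_proj (h0.trans hlm) h1 a)
  · gcongr
  · simpa [ha] using hlm

theorem inv_komornikLoreti_pos : 0 < komornikLoreti⁻¹ :=
  inv_pos.2 isKomornikLoreti_komornikLoreti.1

theorem hasSum_inv_komornikLoreti :
    HasSum (fun n => ((morseTail n : ℕ) : ℝ) * komornikLoreti⁻¹ ^ (n + 1)) 1 := by
  have h := isKomornikLoreti_komornikLoreti.2
  rw [← hasSum_nat_add_iff' 1] at h
  have h0 : thueMorse 0 = 0 := by simp [thueMorse]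
  simp only [Finset.range_one, Finset.sum_singleton, h0, Nat.cast_zero, zero_mul, sub_zero] at h
  convert! h using 2 with n
  rw [inv_pow, morseTail, shift, morseSeq, add_comm 1 n]

theorem inv_komornikLoreti_lt_one : komornikLoreti⁻¹ < 1 := by
  have h := sum_le_hasSum (Finset.range 2)
    (fun n _ => by have := inv_komornikLoreti_pos; positivity) hasSum_inv_komornikLoreti
  simp only [Finset.sum_range_succ, Finset.range_zero, Finset.sum_empty, morseTail_zero,
    morseTail_prefix.1] at h
  have := pow_pos inv_komornikLoreti_pos 2
  simp only [Fin.val_one, Nat.cast_one, one_mul, zero_add, pow_one, Nat.reduceAdd] at h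
  linarith

theorem proj_inv_komornikLoreti : proj komornikLoreti⁻¹ morseTail = 1 :=
  hasSum_inv_komornikLoreti.tsum_eq

theorem exists_pow_two_pow_sub_one_mul_lt (h0 : 0 < l) (h1 : l < 1) (K : ℝ) {δ : ℝ} (hδ : 0 < δ) :
    ∃ n : ℕ, l ^ (2 ^ n - 1) * K < δ := by
  have ht : Tendsto (fun n : ℕ => l ^ n * |K|) atTop (𝓝 0) := by
    simpa using (tendsto_pow_atTop_nhds_zero_of_lt_one h0.le h1).mul_const |K|
  obtain ⟨n, hn⟩ := (ht.eventually_lt_const hδ).exists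
  refine ⟨n, lt_of_le_of_lt ?_ hn⟩
  have hle : l ^ (2 ^ n - 1) ≤ l ^ n :=
    pow_le_pow_of_le_one h0.le h1.le (Nat.le_sub_one_of_lt Nat.lt_two_pow_self)
  calc l ^ (2 ^ n - 1) * K ≤ l ^ (2 ^ n - 1) * |K| := by gcongr; exact le_abs_self K
    _ ≤ l ^ n * |K| := by gcongr

theorem le_of_forall_le_add_pow_mul (h0 : 0 < l) (h1 : l < 1) {x y K : ℝ}
    (h : ∀ k : ℕ, x ≤ y + l ^ k * K) : x ≤ y := by
  refine ge_of_tendsto' (x := atTop) (f := fun k : ℕ => y + l ^ k * K) ?_ h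
  simpa using ((tendsto_pow_atTop_nhds_zero_of_lt_one h0.le h1).mul_const K).const_add y

theorem fin_two_eq_zero_of_le_of_ne {u v : Fin 2} (h : u ≤ v) (hne : u ≠ v) : u = 0 ∧ v = 1 := by
  revert u v; decide

/-- Projection is not monotone for l > 1/2, but at the first difference from T the tail has a 0, and
what follows that 0 obeys the same hypothesis. The crude bound thus improves by a factor l each
time. Agreement with T on all N digits is paid for by l^N · l/(1-l). -/
theorem MorseBdd.halfSep (h0 : 0 < l) (h1 : l < 1) {ε : ℝ} (hε : 0 ≤ ε) {N : ℕ} {a : ℕ → Fin 2}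
    (ha : MorseBdd N a) (hN : proj l morseTail + l ^ N * (l / (1 - l)) ≤ 1 - ε) :
    HalfSep l ε a := by
  have hl1 : 0 < 1 - l := by linarith
  set K := l / (1 - l) with hK
  have hKpos : 0 < K := by positivity
  suffices h : ∀ k n, a n = 0 → proj l (shift a (n + 1)) ≤ 1 - ε + l ^ k * K from
    fun n hn => le_of_forall_le_add_pow_mul h0 h1 fun k => h k n hn
  intro k
  induction k with
  | zero =>
    intro n _
    have := proj_le h0 h1 (shift a (n + 1))
    have h2 := proj_nonneg h0 morseTail
    have : 0 ≤ l ^ N * K := by positivity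
    rw [pow_zero, one_mul]
    linarith
  | succ k ih =>
    intro n hn
    by_cases hag : ∀ i < N, shift a (n + 1) i = morseTail i
    · have h2 := proj_sub_of_agree h0 h1 hag
      have h3 := mul_le_mul_of_nonneg_left (sub_le_self (proj l (shift (shift a (n + 1)) N))
        (proj_nonneg h0 (shift morseTail N))) (pow_pos h0 N).le
      have h4 := mul_le_mul_of_nonneg_left (proj_le h0 h1 (shift (shift a (n + 1)) N))
        (pow_pos h0 N).le
      have : 0 ≤ l ^ (k + 1) * K := by positivity
      linarith
    · simp only [not_forall] at hag
      obtain ⟨i, hi, hne⟩ := hag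
      obtain ⟨j, hji, hlt, hj⟩ := exists_first_ne hne
      obtain ⟨hz, ho⟩ := fin_two_eq_zero_of_le_of_ne (ha n hn j (by omega) hlt) hj
      have h2 := proj_sub_of_agree h0 h1 hlt
      rw [proj_shift_of_zero h0 h1 hz, proj_shift_of_one h0 h1 ho, shift_shift] at h2
      have h3 := ih (n + 1 + j) hz
      have h4 := proj_nonneg h0 (shift morseTail (j + 1))
      have hjl : 0 < l ^ j := by positivity
      have h5 : l ^ j * (l * proj l (shift a (n + 1 + (j + 1))) -
          (l + l * proj l (shift morseTail (j + 1)))) ≤ l ^ j * (l * (l ^ k * K)) := by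
        refine mul_le_mul_of_nonneg_left ?_ hjl.le
        have := mul_le_mul_of_nonneg_left h3 h0.le
        have := mul_nonneg h0.le h4
        have := mul_nonneg h0.le hε
        rw [← add_assoc (n + 1)]
        linarith
      have h6 : l ^ j * (l * (l ^ k * K)) ≤ 1 * (l * (l ^ k * K)) :=
        mul_le_mul_of_nonneg_right (pow_le_one₀ h0.le h1.le) (by positivity)
      have h7 : 0 ≤ l ^ N * K := by positivity
      rw [pow_succ']
      linarith

theorem morse_iterate_apply (b : ℕ → Fin 2) (n i : ℕ) : morse^[n] b (2 ^ n * i) = b i := by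
  induction n generalizing i with
  | zero => simp
  | succ n ih => rw [Function.iterate_succ_apply', pow_succ', mul_assoc, morse_even, ih]

theorem morseBdd_iterate (b : ℕ → Fin 2) (n : ℕ) : MorseBdd (2 ^ n - 1) (morse^[n] b) := by
  induction n with
  | zero => exact fun n _ j hj => by simp at hj
  | succ n ih =>
    have e : 2 ^ (n + 1) - 1 = 2 * (2 ^ n - 1) + 1 := by
      have := Nat.one_le_two_pow (n := n)
      rw [pow_succ]
      omega
    rw [e, Function.iterate_succ_apply']
    exact ih.morse

theorem flip_morse_iterate (b : ℕ → Fin 2) (n : ℕ) : flip (morse^[n] b) = morse^[n] (flip b) := by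
  induction n with
  | zero => rfl
  | succ n ih => rw [Function.iterate_succ_apply', Function.iterate_succ_apply', flip_morse, ih]

theorem dimH_wellSepUniqueExp_pos (h0 : 1 / 2 < l) (hl : l < komornikLoreti⁻¹) :
    0 < dimH (wellSepUniqueExp l) := by
  have hl0 : 0 < l := by linarith
  have h1 : l < 1 := hl.trans inv_komornikLoreti_lt_one
  have hT : proj l morseTail < 1 :=
    (proj_lt_proj hl0 hl inv_komornikLoreti_lt_one morseTail_zero).trans_eq
      proj_inv_komornikLoreti
  obtain ⟨n, hn⟩ := exists_pow_two_pow_sub_one_mul_lt hl0 h1 (l / (1 - l)) (sub_pos.2 hT)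
  set ε := 1 - proj l morseTail - l ^ (2 ^ n - 1) * (l / (1 - l)) with hε
  have hε0 : 0 < ε := by linarith
  have hsep : ∀ c, HalfSep l ε (morse^[n] c) := fun c =>
    (morseBdd_iterate c n).halfSep hl0 h1 hε0.le (by rw [hε]; linarith)
  have hE : ∀ c, HalfSep l ε (morse^[n] c) ∧ HalfSep l ε (flip (morse^[n] c)) := fun c =>
    ⟨hsep c, by rw [flip_morse_iterate]; exact hsep _⟩
  -- The i-th digit of c reappears at place 2^n i of φ^n(c).
  have h2 := le_dimH_of_coding (ρ := 2 ^ n) hl0 h1 hε0 (by positivity) hE fun c c' i hi =>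
    ⟨2 ^ n * i, by push_cast; exact le_rfl, by rwa [morse_iterate_apply, morse_iterate_apply]⟩
  have h3 : 0 < simDim l / 2 ^ n := div_pos (simDim_pos hl0 h1) (by positivity)
  exact (ENNReal.ofReal_pos.2 h3).trans_le
    (h2.trans (dimH_mono (range_subset_wellSepUniqueExp h0 h1 hε0 hE)))

/-! ### Dimension near 1/2 -/

/-- Insert the word 01 after every `M` digits. -/
def pad (M : ℕ) (c : ℕ → Fin 2) : ℕ → Fin 2 := fun p =>
  if p % (M + 2) < M then c (M * (p / (M + 2)) + p % (M + 2))
  else if p % (M + 2) = M then 0 else 1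

theorem exists_add_mod_eq {W : ℕ} (s : ℕ) {j : ℕ} (hj : j < W) : ∃ i < W, (s + i) % W = j := by
  have hr := Nat.mod_lt s (by omega : 0 < W)
  have hs := Nat.div_add_mod s W
  rcases le_or_gt (s % W) j with h | h
  · refine ⟨j - s % W, by omega, ?_⟩
    rw [show s + (j - s % W) = W * (s / W) + j by omega, Nat.mul_add_mod, Nat.mod_eq_of_lt hj]
  · refine ⟨W + j - s % W, by omega, ?_⟩
    rw [show s + (W + j - s % W) = W * (s / W + 1) + j by rw [mul_add]; omega,
      Nat.mul_add_mod, Nat.mod_eq_of_lt hj]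

theorem proj_le_of_exists_zero (h0 : 0 < l) (h1 : l < 1) {W : ℕ} {t : ℕ → Fin 2}
    (h : ∃ i < W, t i = 0) : proj l t ≤ l / (1 - l) - l ^ W := by
  obtain ⟨i, hi, ht⟩ := h
  have h2 := sum_le_proj h0 h1 (flip t) (i + 1)
  rw [Finset.sum_range_succ, proj_flip h0 h1] at h2
  have h3 : 0 ≤ ∑ j ∈ Finset.range i, ((flip t j : ℕ) : ℝ) * l ^ (j + 1) :=
    Finset.sum_nonneg fun j _ => by positivity
  have h4 : l ^ W ≤ l ^ (i + 1) := pow_le_pow_of_le_one h0.le h1.le hi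
  simp only [flip, ht, sub_zero, Fin.val_one, Nat.cast_one, one_mul] at h2 h3
  linarith

/-- Every window of M + 2 digits contains both markers 0 and 1, so each tail of the sequence or its
reflection misses at least l^(M+2) from the maximal projection. -/
theorem pad_halfSep (h0 : 0 < l) (h1 : l < 1) (M : ℕ) (c : ℕ → Fin 2) :
    HalfSep l (1 - (l / (1 - l) - l ^ (M + 2))) (pad M c) ∧
      HalfSep l (1 - (l / (1 - l) - l ^ (M + 2))) (flip (pad M c)) := by
  constructor
  · intro n _
    rw [sub_sub_cancel]
    obtain ⟨i, hi, hm⟩ := exists_add_mod_eq (W := M + 2) (n + 1) (j := M) (by omega)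
    exact proj_le_of_exists_zero h0 h1 ⟨i, hi, by simp [shift, pad, hm]⟩
  · intro n _
    rw [sub_sub_cancel]
    obtain ⟨i, hi, hm⟩ := exists_add_mod_eq (W := M + 2) (n + 1) (j := M + 1) (by omega)
    exact proj_le_of_exists_zero h0 h1 ⟨i, hi, by simp [shift, flip, pad, hm]⟩

theorem pad_apply {M : ℕ} (hM : 0 < M) (c : ℕ → Fin 2) (i : ℕ) :
    pad M c (i + 2 * (i / M)) = c i := by
  have h1 := Nat.mod_lt i hM
  have h2 := Nat.div_add_mod i M
  have e : i + 2 * (i / M) = (M + 2) * (i / M) + i % M := by rw [add_mul]; omega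
  have h3 : (i + 2 * (i / M)) % (M + 2) = i % M := by
    rw [e, Nat.mul_add_mod, Nat.mod_eq_of_lt (by omega)]
  have h4 : (i + 2 * (i / M)) / (M + 2) = i / M := by
    rw [e, Nat.mul_add_div (by omega), Nat.div_eq_of_lt (h1.trans (by omega)), add_zero]
  rw [pad, h3, h4, if_pos h1, h2]

theorem le_dimH_wellSepUniqueExp (h0 : 1 / 2 < l) (h1 : l < 1) {M : ℕ} (hM : 0 < M)
    (hl : l / (1 - l) - l ^ (M + 2) < 1) :
    ENNReal.ofReal (1 / (1 + 2 / (M : ℝ))) ≤ dimH (wellSepUniqueExp l) := by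
  have hl0 : 0 < l := by linarith
  have hM' : (0 : ℝ) < M := by exact_mod_cast hM
  have h2 := le_dimH_of_coding (ρ := 1 + 2 / (M : ℝ)) hl0 h1 (sub_pos.2 hl) (by positivity)
    (pad_halfSep hl0 h1 M) fun c c' i hi => ⟨i + 2 * (i / M), ?_, by
      rwa [pad_apply hM, pad_apply hM]⟩
  · refine le_trans (ENNReal.ofReal_le_ofReal ?_) (h2.trans (dimH_mono
      (range_subset_wellSepUniqueExp h0 h1 (sub_pos.2 hl) (pad_halfSep hl0 h1 M))))
    gcongr
    exact (one_lt_simDim h0 h1).le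
  · push_cast
    have h3 : ((i / M : ℕ) : ℝ) ≤ i / M := Nat.cast_div_le
    calc (i : ℝ) + 2 * ((i / M : ℕ) : ℝ) ≤ i + 2 * (i / M) := by gcongr
      _ = (1 + 2 / (M : ℝ)) * i := by ring

theorem tendsto_dimH_wellSepUniqueExp :
    Tendsto (fun l : ℝ => dimH (wellSepUniqueExp l)) (𝓝[>] (1 / 2)) (𝓝 1) := by
  refine tendsto_order.2 ⟨fun a ha => ?_, fun b hb => Eventually.of_forall fun l => ?_⟩
  · have hlim : Tendsto (fun M : ℕ => ENNReal.ofReal (1 / (1 + 2 / (M : ℝ)))) atTop (𝓝 1) := by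
      rw [← ENNReal.ofReal_one]
      refine ENNReal.tendsto_ofReal ?_
      have h2 := tendsto_const_div_atTop_nhds_zero_nat (2 : ℝ)
      simpa using (h2.const_add 1).inv₀ (by norm_num)
    obtain ⟨M, hM, hM0⟩ :=
      ((hlim.eventually_const_lt ha).and (eventually_gt_atTop 0)).exists
    have hcont : ContinuousAt (fun l : ℝ => l / (1 - l) - l ^ (M + 2)) (1 / 2) := by
      refine ContinuousAt.sub (ContinuousAt.div continuousAt_id (by fun_prop) (by norm_num))
        (by fun_prop)
    -- At l = 1/2 the left side is 1 - 2^(-(M+2)).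
    have hev : ∀ᶠ l : ℝ in 𝓝 (1 / 2), l / (1 - l) - l ^ (M + 2) < 1 := by
      refine hcont.tendsto.eventually_lt_const ?_
      have : (0 : ℝ) < (1 / 2) ^ (M + 2) := by positivity
      norm_num at this ⊢
    filter_upwards [hev.filter_mono nhdsWithin_le_nhds,
      Ioo_mem_nhdsGT (show (1 / 2 : ℝ) < 1 by norm_num)] with l hl hl1
    exact hM.trans_le (le_dimH_wellSepUniqueExp hl1.1 hl1.2 hM0 hl)
  · exact ((dimH_mono (subset_univ _)).trans_eq Real.dimH_univ).trans_lt hb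

/-! ### Infinitely many points below the golden ratio -/

theorem recGolden_lt_one : recGolden < 1 := by
  have h5 : √5 ^ 2 = 5 := Real.sq_sqrt (by norm_num)
  have := Real.sqrt_nonneg 5
  rw [recGolden]
  nlinarith

theorem add_sq_lt_one (h0 : 0 < l) (hl : l < recGolden) : l + l ^ 2 < 1 := by
  have h5 : √5 ^ 2 = 5 := Real.sq_sqrt (by norm_num)
  have h := hl
  rw [recGolden] at h
  nlinarith

theorem proj_le_of_no_double_one (h0 : 0 < l) (h1 : l < 1) {a : ℕ → Fin 2}
    (ha : ∀ n, a n = 1 → a (n + 1) = 0) : proj l a ≤ l / (1 - l ^ 2) := by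
  have h2 : 0 < 1 - l ^ 2 := by nlinarith
  set B := l / (1 - l ^ 2) with hB
  have hBpos : 0 < B := by positivity
  -- B is the projection of 101010….
  have hBeq : l + l ^ 2 * B = B := by rw [hB]; field_simp; ring
  suffices h : ∀ k n, proj l (shift a n) ≤ B + l ^ k * (l / (1 - l)) by
    have := le_of_forall_le_add_pow_mul h0 h1 fun k => h k 0
    rwa [shift_zero] at this
  have hK : 0 < l / (1 - l) := div_pos h0 (by linarith)
  intro k
  induction k with
  | zero =>
    intro n
    have := proj_le h0 h1 (shift a n)
    rw [pow_zero, one_mul]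
    linarith
  | succ k ih =>
    intro n
    rw [pow_succ']
    have hk : 0 < l ^ k * (l / (1 - l)) := by positivity
    rcases fin_two_cases (a n) with h | h
    · rw [proj_shift_of_zero h0 h1 h]
      have := mul_le_mul_of_nonneg_left (ih (n + 1)) h0.le
      nlinarith
    · rw [proj_shift_of_one h0 h1 h, proj_shift_of_zero h0 h1 (ha n h)]
      have h3 := mul_le_mul_of_nonneg_left (ih (n + 1 + 1)) (sq_nonneg l)
      have h4 : l ^ 2 * (l ^ k * (l / (1 - l))) ≤ l * (l ^ k * (l / (1 - l))) :=
        mul_le_mul_of_nonneg_right (by nlinarith) hk.le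
      linarith

/-- The sequence `0 … 0 1 0 1 0 …` with `k` leading zeros. -/
def delayedAlternating (k : ℕ) : ℕ → Fin 2 := fun n =>
  if n < k then 0 else if (n - k) % 2 = 0 then 1 else 0

theorem delayedAlternating_eq_one_iff {k n : ℕ} :
    delayedAlternating k n = 1 ↔ k ≤ n ∧ (n - k) % 2 = 0 := by
  rw [delayedAlternating]
  split_ifs with h h' <;> simp <;> omega

theorem delayedAlternating_eq_zero_iff {k n : ℕ} :
    delayedAlternating k n = 0 ↔ ¬ (k ≤ n ∧ (n - k) % 2 = 0) := by
  rw [← delayedAlternating_eq_one_iff]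
  rcases fin_two_cases (delayedAlternating k n) with h | h <;> simp [h]

/-- Behind a 0, neither the sequence nor its reflection contains 11. The resulting gap is positive
exactly when l + l² < 1. -/
theorem delayedAlternating_halfSep (h0 : 0 < l) (h1 : l < 1) (k : ℕ) :
    HalfSep l (1 - l / (1 - l ^ 2)) (delayedAlternating k) ∧
      HalfSep l (1 - l / (1 - l ^ 2)) (flip (delayedAlternating k)) := by
  constructor
  · intro n _
    rw [sub_sub_cancel]
    refine proj_le_of_no_double_one h0 h1 fun m => ?_
    simp only [shift, delayedAlternating_eq_one_iff, delayedAlternating_eq_zero_iff]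
    omega
  · intro n hn
    rw [sub_sub_cancel]
    have hf : ∀ m, (flip (delayedAlternating k) m = 0 ↔ delayedAlternating k m = 1) ∧
        (flip (delayedAlternating k) m = 1 ↔ delayedAlternating k m = 0) := by
      intro m
      rcases fin_two_cases (delayedAlternating k m) with h | h <;> simp [flip, h]
    rw [(hf n).1, delayedAlternating_eq_one_iff] at hn
    refine proj_le_of_no_double_one h0 h1 fun m => ?_
    simp only [shift, hf, delayedAlternating_eq_one_iff, delayedAlternating_eq_zero_iff]
    omega

theorem infinite_wellSepUniqueExp (h0 : 1 / 2 < l) (hl : l < recGolden) :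
    (wellSepUniqueExp l).Infinite := by
  have hl0 : 0 < l := by linarith
  have h1 : l < 1 := hl.trans recGolden_lt_one
  have hε : 0 < 1 - l / (1 - l ^ 2) := by
    have := add_sq_lt_one hl0 hl
    rw [sub_pos, div_lt_one (by linarith)]
    linarith
  refine infinite_of_injective_forall_mem (f := fun k => proj l (delayedAlternating k)) ?_ fun k =>
    (mem_wellSepUniqueExp_iff h0 h1).2 ⟨_, rfl, _, hε, delayedAlternating_halfSep hl0 h1 k⟩
  intro k k' h
  have h2 := eq_of_proj_eq hl0 h1 hε (delayedAlternating_halfSep hl0 h1 k).1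
    (delayedAlternating_halfSep hl0 h1 k).2 h
  have h3 : ∀ j, delayedAlternating j j = 1 := fun j => delayedAlternating_eq_one_iff.2 (by simp)
  have h4 := h3 k
  have h5 := h3 k'
  rw [h2, delayedAlternating_eq_one_iff] at h4
  rw [← h2, delayedAlternating_eq_one_iff] at h5
  omega

/-! ### Countability above the Komornik–Loreti threshold -/

/-- For l ≤ 1/2 every tail projects to at most 1, so a digit 1 outweighs everything that can follow
a 0 in its place. -/
theorem LexLE.proj_le (h0 : 0 < l) (h1 : l ≤ 1 / 2) {N : ℕ} {t s : ℕ → Fin 2} (h : LexLE N t s) :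
    proj l t ≤ proj l s + l ^ N * (l / (1 - l)) := by
  have hl1 : l < 1 := by linarith
  have hK : 0 < l / (1 - l) := div_pos h0 (by linarith)
  have hK1 : l / (1 - l) ≤ 1 := (div_le_one (by linarith)).2 (by linarith)
  by_cases hag : ∀ i < N, t i = s i
  · have h2 := proj_sub_of_agree h0 hl1 hag
    have h3 : l ^ N * (proj l (shift t N) - proj l (shift s N)) ≤ l ^ N * (l / (1 - l)) := by
      gcongr
      have := BernoulliConv.proj_le h0 hl1 (shift t N)
      have := proj_nonneg h0 (shift s N)
      linarith
    linarith
  · simp only [not_forall] at hag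
    obtain ⟨i, hi, hne⟩ := hag
    obtain ⟨j, hji, hlt, hj⟩ := exists_first_ne hne
    obtain ⟨hz, ho⟩ := fin_two_eq_zero_of_le_of_ne (h j (by omega) hlt) hj
    have h2 := proj_sub_of_agree h0 hl1 hlt
    rw [proj_shift_of_zero h0 hl1 hz, proj_shift_of_one h0 hl1 ho] at h2
    have h3 := (BernoulliConv.proj_le h0 hl1 (shift t (j + 1))).trans hK1
    have h4 := mul_le_mul_of_nonneg_left h3 h0.le
    have h5 := mul_nonneg h0.le (proj_nonneg h0 (shift s (j + 1)))
    have h6 : l ^ j * (l * proj l (shift t (j + 1)) - (l + l * proj l (shift s (j + 1)))) ≤ 0 :=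
      mul_nonpos_of_nonneg_of_nonpos (by positivity) (by linarith)
    have : 0 < l ^ N * (l / (1 - l)) := by positivity
    linarith

/-- T begins 1101001100. If the claim failed, then l < 0.5592, and everything in T after 1101 would
contribute at most l⁶, giving a projection below 1. -/
theorem one_le_of_one_lt_proj_morseTail (h0 : 0 < l) (h1 : l < 1) (hT : 1 < proj l morseTail) :
    1 ≤ l + l ^ 2 + l ^ 4 + l ^ 6 := by
  by_contra! hlt
  have hl : l < 0.5592 := by
    by_contra! hge
    have h2 : (0.5592 : ℝ) ^ 2 ≤ l ^ 2 := by gcongr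
    have h4 : (0.5592 : ℝ) ^ 4 ≤ l ^ 4 := by gcongr
    have h6 : (0.5592 : ℝ) ^ 6 ≤ l ^ 6 := by gcongr
    norm_num at h2 h4 h6 hge
    linarith
  obtain ⟨t1, t2, t3, t4, t5⟩ := morseTail_prefix
  have t6 : morseTail 6 = 1 := by rw [morseTail_even 2, t2]; rfl
  have t7 : morseTail 7 = 1 := (morseTail_odd 3).trans t3
  have t8 : morseTail 8 = 0 := by rw [morseTail_even 3, t3]; rfl
  have t9 : morseTail 9 = 0 := (morseTail_odd 4).trans t4
  have hs := proj_eq_sum_add h0 h1 morseTail 10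
  simp only [Finset.sum_range_succ, Finset.range_zero, Finset.sum_empty, morseTail_zero, t1, t2, t3,
    t4, t5, t6, t7, t8, t9] at hs
  norm_num at hs
  have hK := mul_le_mul_of_nonneg_left (proj_le h0 h1 (shift morseTail 10)) (pow_pos h0 10).le
  have h2 : l ^ 2 ≤ (0.5592 : ℝ) ^ 2 := by gcongr
  have h5 : l ^ 5 ≤ (0.5592 : ℝ) ^ 5 := by gcongr
  have h6 : l ^ 5 / (1 - l) ≤ (0.5592 : ℝ) ^ 5 / (1 - 0.5592) :=
    div_le_div₀ (by norm_num) h5 (by norm_num) (by linarith)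
  have h7 : l + l ^ 2 + l ^ 5 / (1 - l) ≤ 1 := by
    norm_num at h2 h6 hl
    linarith
  have h8 := mul_le_mul_of_nonneg_left h7 (pow_pos h0 6).le
  have h9 : l ^ 6 * (l + l ^ 2 + l ^ 5 / (1 - l)) = l ^ 7 + l ^ 8 + l ^ 10 * (l / (1 - l)) := by
    ring
  linarith

/-- Each of the forbidden words 111, 11011, 110101 already projects to at least l + l² + l⁴ + l⁶ ≥
1, using l³ ≥ l⁴ + l⁶ and l⁵ ≥ l⁶. -/
theorem HalfSep.morseBdd_six (h0 : 1 / 2 < l) (hl : l + l ^ 2 < 1) {ε : ℝ} (hε : 0 < ε)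
    (hp : 1 ≤ l + l ^ 2 + l ^ 4 + l ^ 6) {a : ℕ → Fin 2} (ha : HalfSep l ε a) : MorseBdd 6 a := by
  have hl0 : 0 < l := by linarith
  have h1 : l < 1 := by nlinarith
  have h65 : l ^ 6 ≤ l ^ 5 := pow_le_pow_of_le_one hl0.le h1.le (by norm_num)
  have h43 : l ^ 4 + l ^ 6 ≤ l ^ 3 := by
    have h32 : l ^ 3 ≤ l ^ 2 := pow_le_pow_of_le_one hl0.le h1.le (by norm_num)
    have := mul_le_mul_of_nonneg_left (show l + l ^ 3 ≤ 1 by linarith) (pow_pos hl0 3).le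
    linarith
  rw [morseBdd_six_iff]
  intro n hn e1 e2
  have hs := (sum_le_proj hl0 h1 (shift a (n + 1)) 6).trans (ha n hn)
  have e : ∀ i, shift a (n + 1) i = a (n + (i + 1)) := fun i => by
    simp only [shift]; congr 1; omega
  have h3 := pow_pos hl0 3
  have h4 := pow_pos hl0 4
  have h5 := pow_pos hl0 5
  have h6 := pow_pos hl0 6
  simp only [Finset.sum_range_succ, Finset.range_zero, Finset.sum_empty, e, zero_add,
    Nat.reduceAdd, e1, e2] at hs
  rcases fin_two_cases (a (n + 3)) with e3 | e3 <;> rcases fin_two_cases (a (n + 4)) with e4 | e4 <;>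
    rcases fin_two_cases (a (n + 5)) with e5 | e5 <;>
    rcases fin_two_cases (a (n + 6)) with e6 | e6 <;> simp [e3, e4, e5, e6] at hs ⊢ <;> linarith

/-- If a tail t of b behind a 0 were at least T on N digits, then 1φ(t) would project to at least
the projection of T = 1φ(T) up to an error smaller than its excess over 1. That contradicts
separation. -/
theorem HalfSep.morseStrict (h0 : 0 < l) (hl : l + l ^ 2 < 1) {ε : ℝ} (hε : 0 < ε) {N : ℕ}
    (hN : (l ^ 2) ^ N * (l ^ 2 / (1 - l ^ 2)) < proj l morseTail - 1) {b : ℕ → Fin 2}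
    (hb : HalfSep l ε (morse b)) : MorseStrict N b := by
  intro n hn hle
  have h1 : l < 1 := by nlinarith
  have hq : l ^ 2 ≤ 1 / 2 := by nlinarith
  have h2 := hb (2 * n) (by rwa [morse_even])
  have h3 := hle.proj_le (by positivity) hq
  have h4 : proj l morseTail = l + l * proj l (morse morseTail) := by
    have := proj_eq_head h0 h1 morseTail
    rw [morseTail_zero, show shift morseTail 1 = morse morseTail from
      funext fun n => by rw [← morseTail_succ, shift, add_comm]] at this
    simpa using this
  rw [proj_shift_of_one h0 h1 (by rw [morse_odd, hn]; rfl),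
    show 2 * n + 1 + 1 = 2 * (n + 1) by ring, shift_morse, proj_morse h0 h1] at h2
  rw [proj_morse h0 h1] at h4
  have e : ∀ x y : ℝ, l + l * ((1 - l) / l * x + y) = l + (1 - l) * x + l * y := by
    intro x y; field_simp; ring
  rw [e] at h2 h4
  have h5 := mul_le_mul_of_nonneg_left h3 (show 0 ≤ 1 - l by linarith)
  have h6 : 0 ≤ (l ^ 2) ^ N * (l ^ 2 / (1 - l ^ 2)) :=
    mul_nonneg (by positivity) (div_nonneg (by positivity) (by nlinarith))
  nlinarith

theorem HalfSep.shift {ε : ℝ} {a : ℕ → Fin 2} (h : HalfSep l ε a) (k : ℕ) :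
    HalfSep l ε (shift a k) := by
  intro n hn
  rw [shift_shift, ← add_assoc]
  exact h (k + n) hn

theorem countable_wellSepUniqueExp (h0 : 1 / 2 < l) (hκ : komornikLoreti⁻¹ < l)
    (hl : l < recGolden) : (wellSepUniqueExp l).Countable := by
  have hl0 : 0 < l := by linarith
  have h1 : l < 1 := hl.trans recGolden_lt_one
  have hT : 1 < proj l morseTail := by
    rw [← proj_inv_komornikLoreti]
    exact proj_lt_proj inv_komornikLoreti_pos hκ h1 morseTail_zero
  have hg := add_sq_lt_one hl0 hl
  have hp := one_le_of_one_lt_proj_morseTail hl0 h1 hT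
  obtain ⟨n, hn⟩ := exists_pow_two_pow_sub_one_mul_lt (l := l ^ 2) (by positivity) (by nlinarith)
    (l ^ 2 / (1 - l ^ 2)) (sub_pos.2 hT)
  have hc : {a | ∃ ε > 0, HalfSep l ε a ∧ HalfSep l ε (flip a)}.Countable := by
    refine countable_of_shift_eq_morse (countable_morseStrict n) ?_ ?_
    · rintro a ⟨ε, hε, ha, ha'⟩
      exact ⟨ha.morseBdd_six h0 hg hε hp, ha'.morseBdd_six h0 hg hε hp⟩
    · rintro a ⟨ε, hε, ha, ha'⟩ k b hb
      refine ⟨(hb ▸ ha.shift k).morseStrict hl0 hg hε hn, HalfSep.morseStrict hl0 hg hε hn ?_⟩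
      rw [← flip_morse, ← hb, flip_shift]
      exact ha'.shift k
  refine (hc.image (proj l)).mono fun x hx => ?_
  obtain ⟨a, rfl, ha⟩ := (mem_wellSepUniqueExp_iff h0 h1).1 hx
  exact ⟨a, ha, rfl⟩

/-- T begins 110, so at a parameter at most 1/2 it projects to at most 1/2 + 1/4 + 1/8 < 1. -/
theorem half_lt_inv_komornikLoreti : 1 / 2 < komornikLoreti⁻¹ := by
  by_contra! h
  have h0 := inv_komornikLoreti_pos
  have h1 := inv_komornikLoreti_lt_one
  have hs := proj_eq_sum_add h0 h1 morseTail 3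
  simp only [Finset.sum_range_succ, Finset.range_zero, Finset.sum_empty, morseTail_zero,
    morseTail_prefix.1, morseTail_prefix.2.1, proj_inv_komornikLoreti] at hs
  set y := komornikLoreti⁻¹
  have hK := (proj_le h0 h1 (shift morseTail 3)).trans
    ((div_le_one (by linarith)).2 (by linarith : y ≤ 1 - y))
  have hK' := mul_le_mul_of_nonneg_left hK (pow_pos h0 3).le
  have h2 : y ^ 2 ≤ (1 / 2) ^ 2 := by gcongr
  have h3 : y ^ 3 ≤ (1 / 2) ^ 3 := by gcongr
  norm_num at hs h2 h3
  linarith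

end

end BernoulliConv
end

theorem mainTheorem1 :
    (∀ l : ℝ, 1 / 2 < l → l < recGolden →
      wellSepUniqueExp l ⊆ suppInterval l ∧ 1 < simDim l ∧
        ∀ x ∈ wellSepUniqueExp l, HasLocalDim (bernoulliConvolution l) x (simDim l)) ∧
    (∀ l : ℝ, komornikLoreti⁻¹ < l → l < recGolden →
      (wellSepUniqueExp l).Countable ∧ (wellSepUniqueExp l).Infinite) ∧
    (∀ l : ℝ, 1 / 2 < l → l < komornikLoreti⁻¹ → 0 < dimH (wellSepUniqueExp l)) ∧
    Tendsto (fun l : ℝ => dimH (wellSepUniqueExp l)) (𝓝[>] (1 / 2)) (𝓝 1) := by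
  refine ⟨fun l h0 hl => ?_, fun l hκ hl => ?_, fun l h0 hl => dimH_wellSepUniqueExp_pos h0 hl,
    tendsto_dimH_wellSepUniqueExp⟩
  · have h1 : l < 1 := hl.trans recGolden_lt_one
    refine ⟨fun x hx => hx.1.1, one_lt_simDim h0 h1, fun x hx => ?_⟩
    obtain ⟨a, rfl, ε, hε, ha, ha'⟩ := (mem_wellSepUniqueExp_iff h0 h1).1 hx
    exact hasLocalDim_of_halfSep (by linarith) h1 hε ha ha'
  · have h0 := half_lt_inv_komornikLoreti.trans hκ
    exact ⟨countable_wellSepUniqueExp h0 hκ hl, infinite_wellSepUniqueExp h0 hl⟩
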